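/- Let $d\ge 1$, $\alpha\in\mathbb R$ and $0\le\sigma\le 1$. Let $\mathcal F_-(\mathcal H)$ denote the antisymmetric Fock space over $\mathcal H$. The reservoir has one-particle space $\mathcal H_r=\ell^2(\mathbb Z)$ with canonical basis $(\Psi_j)_{j\in\mathbb Z}$, and the sample has one-particle space $\mathcal H_s=\ell^2(\{0,\dots,d-1\})$ with canonical basis $(e_j)$. Write $b^*(\phi),b(\phi)$ and $a^*(\psi),a(\psi)$ for the fermionic creation and annihilation operators on $\mathcal F_-(\mathcal H_r)$ and $\mathcal F_-(\mathcal H_s)$, $b_j=b(\Psi_j)$, $a_j=a(e_j)$, $n^r_j=b_j^*b_j$, $n^s_j=a_j^*a_j$, $N_s=\sum_{j=0}^{d-1}n^s_j$, and let $\mathcal B$, $\mathcal A$ be the $C^*$-algebras generated by the $b(\phi)$, respectively the $a(\psi)$. Let $S\Psi_j=\Psi_{j-1}$ on $\mathcal H_r$, $S_pe_j=e_{j-1 \bmod d}$ on $\mathcal H_s$, and let $\Gamma(\cdot)$ be second quantization, $\Gamma(W)(u_1\wedge\dots\wedge u_p)=Wu_1\wedge\dots\wedge Wu_p$. On $\mathcal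 F=\mathcal F_-(\mathcal H_r)\otimes\mathcal F_-(\mathcal H_s)$ put $$U=(\Gamma(S)\otimes\Gamma(S_p))\,\exp\!\big[-i\alpha(b_0^*\otimes a_0+b_0\otimes a_0^*)\big],\qquad \tau^t(X)=U^{*t}XU^t\quad(t\in\mathbb N).$$ Let $\omega$ be a gauge-invariant quasi-free state with density $\Sigma=\sigma\mathbb I$ on $\mathcal B$, i.e. a state with $$\omega\big(b^*(\phi_m)\cdots b^*(\phi_1)b(\psi_1)\cdots b(\psi_n)\big)=\delta_{nm}\det\big(\langle\psi_j,\sigma\phi_k\rangle\big)_{j,k},$$ and for $X\in\mathcal B\otimes\mathcal A$ let $\omega(X):=(\omega\otimes\mathrm{id})(X)$, an operator on $\mathcal F_-(\mathcal H_s)$. For a sign $\varepsilon\in\{1,-1\}$ let the flux observable be $$\Phi_r=\sin^2\alpha\,\big(\mathbb I\otimes n^s_0-n^r_0\otimes\mathbb I\big)+i\varepsilon\sin\alpha\cos\alpha\,\big(b_0^*\otimes a_0-b_0\otimes a_0^*\big).$$ (For $\varepsilon=-1$ this is the expression of the formal variation $U^*N_rU-N_r$ of the reservoir number operator $N_r=\sum_jn^r_j$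 in one time step; $\varepsilon=1$ corresponds to the opposite sign convention for $\alpha$ in the coupling.) Then for either sign $\varepsilon$, the operators $\tau^t(\Phi_r)$ and $\tau^t(\mathbb I\otimes N_s)$ belong to $\mathcal B\otimes\mathcal A$ for all $t\in\mathbb N$, and: 1. for all $t=md+u$ with $m\in\mathbb N=\{0,1,2,\dots\}$ and $u\in\{0,\dots,d-1\}$, $$\omega(\tau^t(\Phi_r))=\sin^2\alpha\,\cos^{2m}\alpha\,\big(n^s_u-\sigma\mathbb I\big);$$ 2. for all $t=md$ with $m\in\mathbb N$, $$\sum_{j=0}^{t-1}\omega(\tau^j(\Phi_r))=(N_s-\sigma d\,\mathbb I)(1-\cos^{2m}\alpha)=N_s-\omega(\tau^t(\mathbb I\otimes N_s)).$$ -/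

import Mathlib

open scoped TensorProduct ComplexConjugate
namespace FermiWalk
noncomputable section

/-- The Hilbert space `ℓ²(ι)`. -/
abbrev OneParticle (ι : Type) : Type := lp (fun _ : ι => ℂ) 2

/-- The canonical basis vector of `ℓ²(ι)` at the site `j`. -/
def site {ι : Type} [LinearOrder ι] (j : ι) : OneParticle ι := lp.single 2 j (1 : ℂ)

/-- The fermionic (antisymmetric) Fock space over `ℓ²(ι)` in the occupation-number representation:
the basis vector at the finite set `S = {i₁ < ... < iₚ}` stands for the normalized elementary
vector `e_{i₁} ∧ ... ∧ e_{iₚ}` (see `wedge_site`), so that `ℓ²` of the `p`-element subsets is the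
`p`-fold antisymmetric tensor product, and the empty set is the vacuum. -/
abbrev Fock (ι : Type) : Type := lp (fun _ : Finset ι => ℂ) 2

/-- The vacuum vector. -/
def vacuum (ι : Type) [LinearOrder ι] : Fock ι := lp.single 2 (∅ : Finset ι) (1 : ℂ)

/-- The sign `(-1)^{#{i ∈ S, i < j}}` of moving `e_j` to its place in `e_j ∧ e_S`. -/
def jwSign {ι : Type} [LinearOrder ι] (j : ι) (S : Finset ι) : ℂ :=
  (-1) ^ (S.filter (fun i => i < j)).card

section SiteCreation
variable {ι : Type} [LinearOrder ι]

theorem norm_jwSign (j : ι) (S : Finset ι) : ‖jwSign j S‖ = 1 := by simp [jwSign]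

theorem jwSign_mul_self (j : ι) (S : Finset ι) : jwSign j S * jwSign j S = 1 := by
  rw [jwSign, ← mul_pow]; simp

theorem conj_jwSign (j : ι) (S : Finset ι) : conj (jwSign j S) = jwSign j S := by simp [jwSign]

theorem jwSign_insert {i j : ι} {S : Finset ι} (hi : i ∉ S) :
    jwSign j (insert i S) = if i < j then -jwSign j S else jwSign j S := by
  unfold jwSign
  rw [Finset.filter_insert]
  split_ifs with h
  · rw [Finset.card_insert_of_notMem (by simp [hi]), pow_succ]; ring
  · rfl

theorem jwSign_erase {i j : ι} {S : Finset ι} (hi : i ∈ S) :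
    jwSign j (S.erase i) = if i < j then -jwSign j S else jwSign j S := by
  have h := jwSign_insert (j := j) (Finset.notMem_erase i S)
  rw [Finset.insert_erase hi] at h
  split_ifs at h ⊢ with h'
  · rw [h, neg_neg]
  · exact h.symm

/-- The formula for `c*_j ψ`, i.e. `c*_j e_S = e_j ∧ e_S`, in coordinates. -/
def siteCreateFun (j : ι) (ψ : Finset ι → ℂ) (S : Finset ι) : ℂ :=
  if j ∈ S then jwSign j S * ψ (S.erase j) else 0

theorem siteCreateFun_sq (j : ι) (ψ : Finset ι → ℂ) :
    (fun S => ‖siteCreateFun j ψ S‖ ^ 2) =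
      Set.indicator {S | j ∈ S} (fun S => ‖ψ (S.erase j)‖ ^ 2) := by
  funext S
  by_cases h : j ∈ S <;> simp [siteCreateFun, h, norm_jwSign]

theorem erase_injOn (j : ι) :
    Function.Injective (fun S : {S : Finset ι | j ∈ S} => (S : Finset ι).erase j) := by
  rintro ⟨S, hS⟩ ⟨T, hT⟩ h
  simp only [Subtype.mk.injEq]
  rw [← Finset.insert_erase hS, ← Finset.insert_erase hT]
  exact congrArg (insert j) h

theorem fock_summable_sq {α : Type} (ψ : Fock α) : Summable (fun S => ‖ψ S‖ ^ 2) := by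
  have := (lp.memℓp ψ).summable (by norm_num)
  simpa using this

theorem fock_norm_sq {α : Type} (ψ : lp (fun _ : α => ℂ) 2) : ‖ψ‖ ^ 2 = ∑' S, ‖ψ S‖ ^ 2 := by
  have := lp.norm_rpow_eq_tsum (p := 2) (by norm_num) ψ
  simpa using this

theorem siteCreateFun_summable (j : ι) (ψ : Fock ι) :
    Summable (fun S => ‖siteCreateFun j ψ S‖ ^ 2) := by
  rw [siteCreateFun_sq, ← summable_subtype_iff_indicator]
  exact (fock_summable_sq ψ).comp_injective (erase_injOn j)

theorem siteCreateFun_tsum_le (j : ι) (ψ : Fock ι) :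
    ∑' S, ‖siteCreateFun j ψ S‖ ^ 2 ≤ ∑' S, ‖ψ S‖ ^ 2 := by
  rw [siteCreateFun_sq, ← tsum_subtype]
  exact ((fock_summable_sq ψ).comp_injective (erase_injOn j)).tsum_le_tsum_of_inj _
    (erase_injOn j) (fun _ _ => by positivity) (fun _ => le_rfl) (fock_summable_sq ψ)

/-- The creation operator `c*_j` at the site `j`. -/
def siteCreate (j : ι) : Fock ι →L[ℂ] Fock ι :=
  LinearMap.mkContinuous
    { toFun := fun ψ => ⟨siteCreateFun j ψ, memℓp_gen (by
        simpa using siteCreateFun_summable j ψ)⟩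
      map_add' := fun ψ χ => by
        ext S
        simp only [siteCreateFun, lp.coeFn_add, Pi.add_apply]
        split_ifs <;> ring
      map_smul' := fun c ψ => by
        ext S
        simp only [siteCreateFun, lp.coeFn_smul, Pi.smul_apply, smul_eq_mul, RingHom.id_apply]
        split_ifs <;> ring } 1 (fun ψ => by
      rw [one_mul, ← sq_le_sq₀ (norm_nonneg _) (norm_nonneg _), fock_norm_sq, fock_norm_sq]
      exact siteCreateFun_tsum_le j ψ)

theorem siteCreate_apply (j : ι) (ψ : Fock ι) (S : Finset ι) :
    siteCreate j ψ S = if j ∈ S then jwSign j S * ψ (S.erase j) else 0 := rfl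

theorem siteCreate_single (j : ι) (S : Finset ι) :
    siteCreate j (lp.single 2 S (1 : ℂ)) =
      if j ∈ S then 0 else lp.single 2 (insert j S) (jwSign j S) := by
  ext T
  rw [siteCreate_apply]
  by_cases hS : j ∈ S
  · rw [if_pos hS]
    by_cases hT : j ∈ T
    · have : T.erase j ≠ S := fun h => by simp [← h] at hS
      simp [hT, this]
    · simp [hT]
  · rw [if_neg hS]
    by_cases hT : j ∈ T
    · by_cases h : T.erase j = S
      · have h' : T = insert j S := by rw [← h, Finset.insert_erase hT]
        have hs : jwSign j T = jwSign j S := by rw [h', jwSign_insert hS]; simp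
        rw [if_pos hT, h, hs, h']; simp
      · have h' : T ≠ insert j S := fun h' => h (by rw [h', Finset.erase_insert hS])
        simp [hT, h, h']
    · have h' : T ≠ insert j S := fun h' => hT (by simp [h'])
      simp [hT, h']

theorem star_siteCreate_apply (j : ι) (ψ : Fock ι) (S : Finset ι) :
    (star (siteCreate j)) ψ S = if j ∈ S then 0 else jwSign j S * ψ (insert j S) := by
  have h : (star (siteCreate j)) ψ S =
      inner ℂ (lp.single 2 S (1 : ℂ) : Fock ι) ((star (siteCreate j)) ψ) := by
    rw [lp.inner_single_left]; simp
  rw [h, ContinuousLinearMap.star_eq_adjoint, ContinuousLinearMap.adjoint_inner_right,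
    siteCreate_single]
  split_ifs with hj
  · simp
  · rw [lp.inner_single_left]; simp [conj_jwSign, mul_comm]

theorem siteCreate_anticomm (i j : ι) :
    siteCreate i * siteCreate j + siteCreate j * siteCreate i = 0 := by
  refine ContinuousLinearMap.ext fun ψ => lp.ext (funext fun S => ?_)
  change siteCreate i (siteCreate j ψ) S + siteCreate j (siteCreate i ψ) S = 0
  simp only [siteCreate_apply]
  by_cases hi : i ∈ S <;> by_cases hj : j ∈ S <;> by_cases hij : i = j <;>
    simp only [hi, hj, if_true, if_false, Finset.mem_erase, ne_eq, not_false_eq_true, and_true,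
      true_and, mul_zero, add_zero, hij, not_true_eq_false, false_and, and_false]
  rw [if_pos (fun h => hij h.symm), jwSign_erase hi, jwSign_erase hj, Finset.erase_right_comm]
  rcases lt_or_gt_of_ne hij with h | h
  · rw [if_pos h, if_neg h.not_gt]; ring
  · rw [if_neg h.not_gt, if_pos h]; ring

theorem star_siteCreate_anticomm (i j : ι) :
    star (siteCreate i) * siteCreate j + siteCreate j * star (siteCreate i) =
      (if i = j then (1 : ℂ) else 0) • (1 : Fock ι →L[ℂ] Fock ι) := by
  refine ContinuousLinearMap.ext fun ψ => lp.ext (funext fun S => ?_)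
  change star (siteCreate i) (siteCreate j ψ) S + siteCreate j (star (siteCreate i) ψ) S =
    (if i = j then (1 : ℂ) else 0) * ψ S
  simp only [siteCreate_apply, star_siteCreate_apply]
  by_cases hij : i = j
  · subst hij
    by_cases hi : i ∈ S
    · simp [hi, ← mul_assoc, jwSign_erase, jwSign_mul_self]
    · simp [hi, ← mul_assoc, jwSign_insert, jwSign_mul_self]
  · have hji : j ≠ i := fun h => hij h.symm
    by_cases hi : i ∈ S
    · simp [hi, hij]
    · by_cases hj : j ∈ S
      · have hs : (insert i S).erase j = insert i (S.erase j) := by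
          rw [Finset.erase_insert_of_ne hij]
        simp only [hi, hj, hij, if_true, if_false, Finset.mem_insert, Finset.mem_erase, or_true,
          and_false, jwSign_insert hi, jwSign_erase hj, hs]
        rcases lt_or_gt_of_ne hij with h | h
        · rw [if_pos h, if_neg h.not_gt]; ring
        · rw [if_neg h.not_gt, if_pos h]; ring
      · simp [hi, hj, hij, hji]

theorem norm_sum_siteCreate_sq_le (φ : ι → ℂ) (s : Finset ι) :
    ‖∑ j ∈ s, φ j • siteCreate j‖ ^ 2 ≤ ∑ j ∈ s, ‖φ j‖ ^ 2 := by
  set T : Fock ι →L[ℂ] Fock ι := ∑ j ∈ s, φ j • siteCreate j with hT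
  have hcar : star T * T + T * star T =
      ((∑ j ∈ s, ‖φ j‖ ^ 2 : ℝ) : ℂ) • (1 : Fock ι →L[ℂ] Fock ι) := by
    have h1 : star T * T + T * star T = ∑ i ∈ s, ∑ j ∈ s, (conj (φ i) * φ j) •
        (star (siteCreate i) * siteCreate j + siteCreate j * star (siteCreate i)) := by
      simp only [hT, star_sum, star_smul, Finset.sum_mul_sum, smul_add, Finset.sum_add_distrib]
      congr 1
      · simp [smul_smul, mul_comm]
      · rw [Finset.sum_comm]; simp [smul_smul]
    rw [h1]
    simp only [star_siteCreate_anticomm, ite_smul, smul_ite, one_smul, zero_smul, smul_zero,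
      Finset.sum_ite_eq]
    rw [Complex.ofReal_sum, Finset.sum_smul]
    refine Finset.sum_congr rfl fun i hi => ?_
    rw [if_pos hi]
    congr 1
    rw [mul_comm, Complex.mul_conj, Complex.normSq_eq_norm_sq]
  have hb : ∀ ψ, ‖T ψ‖ ≤ Real.sqrt (∑ j ∈ s, ‖φ j‖ ^ 2) * ‖ψ‖ := by
    intro ψ
    have h0 : (0 : ℝ) ≤ ∑ j ∈ s, ‖φ j‖ ^ 2 := Finset.sum_nonneg fun _ _ => by positivity
    have h2 : ‖T ψ‖ ^ 2 + ‖star T ψ‖ ^ 2 = (∑ j ∈ s, ‖φ j‖ ^ 2) * ‖ψ‖ ^ 2 := by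
      have h3 := congrArg (fun A : Fock ι →L[ℂ] Fock ι => inner ℂ ψ (A ψ)) hcar
      change inner ℂ ψ (star T (T ψ) + T (star T ψ)) = inner ℂ ψ
        (((∑ j ∈ s, ‖φ j‖ ^ 2 : ℝ) : ℂ) • ψ) at h3
      rw [inner_add_right, inner_smul_right, ContinuousLinearMap.star_eq_adjoint, ContinuousLinearMap.adjoint_inner_right,
        ← ContinuousLinearMap.adjoint_inner_left T (ContinuousLinearMap.adjoint T ψ) ψ, inner_self_eq_norm_sq_to_K,
        inner_self_eq_norm_sq_to_K, inner_self_eq_norm_sq_to_K] at h3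
      rw [ContinuousLinearMap.star_eq_adjoint]
      apply Complex.ofReal_injective
      rw [Complex.ofReal_add, Complex.ofReal_mul, Complex.ofReal_pow, Complex.ofReal_pow,
        Complex.ofReal_pow]
      exact h3
    rw [← sq_le_sq₀ (norm_nonneg _) (by positivity), mul_pow, Real.sq_sqrt h0]
    nlinarith [sq_nonneg ‖star T ψ‖]
  have h4 := T.opNorm_le_bound (Real.sqrt_nonneg _) hb
  calc ‖T‖ ^ 2 ≤ Real.sqrt (∑ j ∈ s, ‖φ j‖ ^ 2) ^ 2 := by gcongr
    _ = _ := Real.sq_sqrt (Finset.sum_nonneg fun _ _ => by positivity)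

theorem summable_creation (φ : OneParticle ι) : Summable fun j => φ j • siteCreate j := by
  have hφ : Summable fun j => ‖φ j‖ ^ 2 := by
    simpa using (lp.memℓp φ).summable (by norm_num)
  rw [summable_iff_vanishing_norm]
  intro ε hε
  obtain ⟨s, hs⟩ := summable_iff_vanishing_norm.1 hφ (ε ^ 2) (by positivity)
  refine ⟨s, fun t ht => ?_⟩
  have h1 := hs t ht
  have h2 := norm_sum_siteCreate_sq_le φ t
  rw [Real.norm_of_nonneg (Finset.sum_nonneg fun _ _ => by positivity)] at h1
  exact lt_of_pow_lt_pow_left₀ 2 hε.le (h2.trans_lt h1)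

end SiteCreation

/-- The creation operator `c*(φ) = ∑_j φ_j c*_j` (norm convergent, `summable_creation`), linear
in `φ`; it satisfies the canonical anticommutation relations proved below and
`c*(φ) (u₁ ∧ ... ∧ u_q) = φ ∧ u₁ ∧ ... ∧ u_q` (`wedge_cons`). -/
def creation {ι : Type} [LinearOrder ι] (φ : OneParticle ι) : Fock ι →L[ℂ] Fock ι :=
  ∑' j, φ j • siteCreate j

/-- The annihilation operator `c(φ)`, the adjoint of `c*(φ)`. -/
def annihilation {ι : Type} [LinearOrder ι] (φ : OneParticle ι) : Fock ι →L[ℂ] Fock ι :=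
  star (creation φ)

section CAR
variable {ι : Type} [LinearOrder ι]

theorem hasSum_creation (φ : OneParticle ι) :
    HasSum (fun j => φ j • siteCreate j) (creation φ) := (summable_creation φ).hasSum

theorem creation_site (j : ι) : creation (site j) = siteCreate j := by
  unfold creation
  rw [tsum_eq_single j]
  · simp [site]
  · intro i hi
    simp [site, hi]

theorem creation_anticomm (φ χ : OneParticle ι) :
    creation φ * creation χ + creation χ * creation φ = 0 := by
  have h1 : ∀ j, creation φ * siteCreate j + siteCreate j * creation φ = 0 := by
    intro j
    refine (((hasSum_creation φ).mul_right (siteCreate j)).add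
      ((hasSum_creation φ).mul_left (siteCreate j))).unique ?_
    have : (fun i => φ i • siteCreate i * siteCreate j + siteCreate j * φ i • siteCreate i) =
        fun _ => 0 := by
      funext i
      rw [smul_mul_assoc, mul_smul_comm, ← smul_add, siteCreate_anticomm, smul_zero]
    rw [this]; exact hasSum_zero
  refine (((hasSum_creation χ).mul_left (creation φ)).add
      ((hasSum_creation χ).mul_right (creation φ))).unique ?_
  have : (fun i => creation φ * χ i • siteCreate i + χ i • siteCreate i * creation φ) =
      fun _ => 0 := by
    funext i
    rw [smul_mul_assoc, mul_smul_comm, ← smul_add, h1, smul_zero]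
  rw [this]; exact hasSum_zero

theorem annihilation_creation_anticomm (φ χ : OneParticle ι) :
    annihilation φ * creation χ + creation χ * annihilation φ =
      (inner ℂ φ χ : ℂ) • (1 : Fock ι →L[ℂ] Fock ι) := by
  have h1 : ∀ i, star (siteCreate i) * creation χ + creation χ * star (siteCreate i) =
      χ i • (1 : Fock ι →L[ℂ] Fock ι) := by
    intro i
    refine (((hasSum_creation χ).mul_left (star (siteCreate i))).add
      ((hasSum_creation χ).mul_right (star (siteCreate i)))).unique ?_
    have : (fun j => star (siteCreate i) * χ j • siteCreate j +
        χ j • siteCreate j * star (siteCreate i)) =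
        fun j => if j = i then χ i • (1 : Fock ι →L[ℂ] Fock ι) else 0 := by
      funext j
      rw [smul_mul_assoc, mul_smul_comm, ← smul_add, star_siteCreate_anticomm]
      by_cases h : i = j
      · subst h; simp
      · rw [if_neg h, zero_smul, smul_zero, if_neg (fun h' => h h'.symm)]
    rw [this]; exact hasSum_ite_eq i _
  have h2 : HasSum (fun i => conj (φ i) • star (siteCreate i)) (annihilation φ) := by
    have := (hasSum_creation φ).star
    simpa [star_smul, annihilation] using this
  refine ((h2.mul_right (creation χ)).add (h2.mul_left (creation χ))).unique ?_
  have : (fun i => conj (φ i) • star (siteCreate i) * creation χ +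
      creation χ * conj (φ i) • star (siteCreate i)) =
      fun i => (inner ℂ (φ i) (χ i) : ℂ) • (1 : Fock ι →L[ℂ] Fock ι) := by
    funext i
    rw [smul_mul_assoc, mul_smul_comm, ← smul_add, h1, smul_smul]
    simp [mul_comm]
  rw [this]
  exact (lp.hasSum_inner φ χ).smul_const _

theorem annihilation_vacuum (φ : OneParticle ι) : annihilation φ (vacuum ι) = 0 := by
  refine ext_inner_left ℂ fun ψ => ?_
  rw [annihilation, ContinuousLinearMap.star_eq_adjoint, ContinuousLinearMap.adjoint_inner_right,
    inner_zero_right]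
  have h : HasSum (fun j => (φ j • siteCreate j) ψ) (creation φ ψ) :=
    (hasSum_creation φ).mapL (ContinuousLinearMap.apply ℂ (Fock ι) ψ)
  have h' : HasSum (fun j => inner ℂ (vacuum ι) ((φ j • siteCreate j) ψ))
      (inner ℂ (vacuum ι) (creation φ ψ)) := h.mapL (innerSL ℂ (vacuum ι))
  have h0 : (fun j => inner ℂ (vacuum ι) ((φ j • siteCreate j) ψ)) = fun _ => (0 : ℂ) := by
    funext j
    simp [vacuum, lp.inner_single_left, siteCreate_apply]
  rw [h0] at h'
  rw [← inner_conj_symm, h'.unique hasSum_zero, map_zero]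

end CAR

theorem orthonormal_site {ι : Type} [LinearOrder ι] : Orthonormal ℂ (site : ι → OneParticle ι) := by
  rw [orthonormal_iff_ite]
  intro i j
  simp [site, lp.inner_single_left, Pi.single_apply]

/-- The linear isometry of `ℓ²(α)` onto the closed span of an orthonormal family `v` that
sends the canonical basis vector at `a` to `v a`. -/
def isometryOfOrthonormal {α E : Type} [NormedAddCommGroup E] [InnerProductSpace ℂ E]
    [CompleteSpace E] {v : α → E} (hv : Orthonormal ℂ v) : lp (fun _ : α => ℂ) 2 →ₗᵢ[ℂ] E :=
  hv.orthogonalFamily.linearIsometry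

theorem isometryOfOrthonormal_single {α E : Type} [DecidableEq α] [NormedAddCommGroup E]
    [InnerProductSpace ℂ E] [CompleteSpace E] {v : α → E} (hv : Orthonormal ℂ v) (a : α) :
    isometryOfOrthonormal hv (lp.single 2 a (1 : ℂ)) = v a := by
  simp [isometryOfOrthonormal]

/-- The elementary vector `u₁ ∧ ... ∧ u_p = c*(u₁) ... c*(u_p) Ω`. -/
def wedge {ι : Type} [LinearOrder ι] (l : List (OneParticle ι)) : Fock ι :=
  (l.map creation).prod (vacuum ι)

section Wedge
variable {ι : Type} [LinearOrder ι]

theorem wedge_cons (φ : OneParticle ι) (l : List (OneParticle ι)) :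
    wedge (φ :: l) = creation φ (wedge l) := by
  rw [wedge, List.map_cons, List.prod_cons]; rfl

theorem annihilation_creation_apply (φ χ : OneParticle ι) (ψ : Fock ι) :
    annihilation φ (creation χ ψ) = (inner ℂ φ χ : ℂ) • ψ - creation χ (annihilation φ ψ) := by
  rw [eq_sub_iff_add_eq]
  exact congrArg (fun A : Fock ι →L[ℂ] Fock ι => A ψ) (annihilation_creation_anticomm φ χ)

theorem creation_creation_apply (φ χ : OneParticle ι) (ψ : Fock ι) :
    creation φ (creation χ ψ) = -creation χ (creation φ ψ) := by
  rw [eq_neg_iff_add_eq_zero]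
  exact congrArg (fun A : Fock ι →L[ℂ] Fock ι => A ψ) (creation_anticomm φ χ)

theorem creation_creation_self (φ : OneParticle ι) (ψ : Fock ι) :
    creation φ (creation φ ψ) = 0 := by
  have h := creation_creation_apply φ φ ψ
  rw [eq_neg_iff_add_eq_zero, ← two_smul ℂ, smul_eq_zero] at h
  exact h.resolve_left two_ne_zero

theorem annihilation_wedge {φ : OneParticle ι} {l : List (OneParticle ι)}
    (h : ∀ χ ∈ l, inner ℂ φ χ = 0) : annihilation φ (wedge l) = 0 := by
  induction l with
  | nil => simpa [wedge] using annihilation_vacuum φ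
  | cons χ l ih =>
    rw [wedge_cons, annihilation_creation_apply, h χ (by simp),
      ih fun χ hχ => h χ (by simp [hχ])]
    simp

theorem creation_wedge_of_mem {φ : OneParticle ι} {l : List (OneParticle ι)} (h : φ ∈ l) :
    creation φ (wedge l) = 0 := by
  induction l with
  | nil => simp at h
  | cons χ l ih =>
    rw [wedge_cons]
    rcases List.mem_cons.1 h with rfl | h
    · exact creation_creation_self _ _
    · rw [creation_creation_apply, ih h]; simp

theorem inner_creation_left (φ : OneParticle ι) (ψ χ : Fock ι) :
    inner ℂ (creation φ ψ) χ = inner ℂ ψ (annihilation φ χ) := by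
  rw [annihilation, ContinuousLinearMap.star_eq_adjoint, ContinuousLinearMap.adjoint_inner_right]

theorem inner_wedge_of_mem {φ : OneParticle ι} {l l' : List (OneParticle ι)}
    (hφ : inner ℂ φ φ = (1 : ℂ)) (h : φ ∈ l) (h' : ∀ χ ∈ l', inner ℂ φ χ = 0) :
    inner ℂ (wedge l) (wedge l') = 0 := by
  have h1 : wedge l = creation φ (annihilation φ (wedge l)) := by
    have := annihilation_creation_apply φ φ (wedge l)
    rw [creation_wedge_of_mem h, hφ, map_zero, one_smul] at this
    exact (sub_eq_zero.1 this.symm)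
  rw [h1, inner_creation_left, annihilation_wedge h', inner_zero_right]

theorem inner_wedge_self {v : ι → OneParticle ι} (hv : Orthonormal ℂ v)
    {l : List ι} (hl : l.Nodup) : inner ℂ (wedge (l.map v)) (wedge (l.map v)) = (1 : ℂ) := by
  induction l with
  | nil => simp [wedge, vacuum, lp.inner_single_left]
  | cons a l ih =>
    rw [List.nodup_cons] at hl
    rw [List.map_cons, wedge_cons, inner_creation_left, annihilation_creation_apply,
      annihilation_wedge, map_zero, sub_zero, inner_smul_right, ih hl.2, mul_one]
    · rw [orthonormal_iff_ite.1 hv]; simp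
    · intro χ hχ
      obtain ⟨b, hb, rfl⟩ := List.mem_map.1 hχ
      exact hv.2 fun h => hl.1 (h ▸ hb)

theorem orthonormal_wedge {v : ι → OneParticle ι} (hv : Orthonormal ℂ v) :
    Orthonormal ℂ (fun S : Finset ι => wedge ((S.sort (· ≤ ·)).map v)) := by
  have hone : ∀ i, inner ℂ (v i) (v i) = (1 : ℂ) := fun i => by
    rw [orthonormal_iff_ite.1 hv]; simp
  have key : ∀ S T : Finset ι, ∀ i ∈ S, i ∉ T →
      inner ℂ (wedge ((S.sort (· ≤ ·)).map v)) (wedge ((T.sort (· ≤ ·)).map v)) = (0 : ℂ) := by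
    intro S T i hi hi'
    refine inner_wedge_of_mem (hone i) (List.mem_map.2 ⟨i, by simpa using hi, rfl⟩) ?_
    intro χ hχ
    obtain ⟨j, hj, rfl⟩ := List.mem_map.1 hχ
    exact hv.2 fun h => hi' (by rw [h]; simpa using hj)
  rw [orthonormal_iff_ite]
  intro S T
  split_ifs with h
  · subst h
    exact inner_wedge_self hv (Finset.sort_nodup _ _)
  · by_cases h' : S ⊆ T
    · obtain ⟨i, hi, hi'⟩ := Finset.not_subset.1 fun h'' => h (Finset.Subset.antisymm h' h'')
      rw [← inner_conj_symm, key T S i hi hi', map_zero]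
    · obtain ⟨i, hi, hi'⟩ := Finset.not_subset.1 h'
      exact key S T i hi hi'

theorem wedge_site (S : Finset ι) :
    wedge ((S.sort (· ≤ ·)).map site) = lp.single 2 S (1 : ℂ) := by
  have key : ∀ l : List ι, l.SortedLT →
      wedge (l.map site) = lp.single 2 l.toFinset (1 : ℂ) := by
    intro l hl
    induction l with
    | nil => simp [wedge, vacuum]
    | cons a l ih =>
      have hp := hl.pairwise
      rw [List.pairwise_cons] at hp
      have ha : a ∉ l.toFinset := fun h => lt_irrefl a (hp.1 a (by simpa using h))
      have hs : jwSign a l.toFinset = 1 := by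
        rw [jwSign, Finset.filter_eq_empty_iff.2]
        · simp
        · intro b hb
          exact (hp.1 b (by simpa using hb)).not_gt
      rw [List.map_cons, wedge_cons, ih hp.2.sortedLT, creation_site, siteCreate_single,
        if_neg ha, hs, List.toFinset_cons]
  simpa using key (S.sort (· ≤ ·)) (Finset.sortedLT_sort S)

end Wedge

/-- The second quantization `Γ(W)` of an isometry (in particular of a unitary) `W` of `ℓ²(ι)`: the
bounded operator with `Γ(W) (e_{i₁} ∧ ... ∧ e_{iₚ}) = W e_{i₁} ∧ ... ∧ W e_{iₚ}`. -/
def secondQuantization {ι : Type} [LinearOrder ι] (W : OneParticle ι →ₗᵢ[ℂ] OneParticle ι) :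
    Fock ι →L[ℂ] Fock ι :=
  (isometryOfOrthonormal
    (orthonormal_wedge (orthonormal_site.comp_linearIsometry W))).toContinuousLinearMap

theorem secondQuantization_wedge_site {ι : Type} [LinearOrder ι]
    (W : OneParticle ι →ₗᵢ[ℂ] OneParticle ι) (S : Finset ι) :
    secondQuantization W (wedge ((S.sort (· ≤ ·)).map site)) =
      wedge ((S.sort (· ≤ ·)).map fun j => W (site j)) := by
  rw [wedge_site]
  exact isometryOfOrthonormal_single
    (orthonormal_wedge (orthonormal_site.comp_linearIsometry W)) S

/-- The shift `S e_j = e_{j-1}`; on `ℓ²(ℤ)` the bilateral shift, and on `ℓ²(Fin d)`, where the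
subtraction is modulo `d`, the periodic shift. -/
def shift (ι : Type) [LinearOrder ι] [AddCommGroup ι] [One ι] :
    OneParticle ι →ₗᵢ[ℂ] OneParticle ι :=
  isometryOfOrthonormal (v := fun j : ι => site (j - 1))
    (orthonormal_site.comp (fun j : ι => j - 1) (sub_left_injective))

theorem shift_site {ι : Type} [LinearOrder ι] [AddCommGroup ι] [One ι] (j : ι) :
    shift ι (site j) = site (j - 1) := isometryOfOrthonormal_single _ j

/-- Bounded operators on `E`, with the operator norm and the adjoint as star. -/
abbrev Op (E : Type) [NormedAddCommGroup E] [InnerProductSpace ℂ E] : Type := E →L[ℂ] E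

/-- The Hilbert space tensor product. -/
abbrev HilbertTensor (E F : Type) [NormedAddCommGroup E] [InnerProductSpace ℂ E]
    [NormedAddCommGroup F] [InnerProductSpace ℂ F] : Type :=
  UniformSpace.Completion (E ⊗[ℂ] F)

/-- The operator `A ⊗ B` on the Hilbert tensor product. -/
def opTensor {E F : Type} [NormedAddCommGroup E] [InnerProductSpace ℂ E]
    [NormedAddCommGroup F] [InnerProductSpace ℂ F] (A : Op E) (B : Op F) :
    Op (HilbertTensor E F) :=
  (TensorProduct.mapL A B).completion

/-- The C*-algebra generated by the creation and annihilation operators on `Fock ι`. -/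
def carAlgebra (ι : Type) [LinearOrder ι] : StarSubalgebra ℂ (Op (Fock ι)) :=
  (StarAlgebra.adjoin ℂ (Set.range (annihilation (ι := ι)))).topologicalClosure

theorem opTensor_coe {E F : Type} [NormedAddCommGroup E] [InnerProductSpace ℂ E]
    [NormedAddCommGroup F] [InnerProductSpace ℂ F] (A : Op E) (B : Op F) (x : E) (y : F) :
    opTensor A B ((x ⊗ₜ[ℂ] y : E ⊗[ℂ] F) : HilbertTensor E F) =
      ((A x ⊗ₜ[ℂ] B y : E ⊗[ℂ] F) : HilbertTensor E F) := by
  rw [opTensor, ContinuousLinearMap.completion_apply_coe, TensorProduct.mapL_tmul]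

theorem op_ext {E F : Type} [NormedAddCommGroup E] [InnerProductSpace ℂ E]
    [NormedAddCommGroup F] [InnerProductSpace ℂ F] {S T : Op (HilbertTensor E F)}
    (h : ∀ (x : E) (y : F), S ((x ⊗ₜ[ℂ] y : E ⊗[ℂ] F) : HilbertTensor E F) =
      T ((x ⊗ₜ[ℂ] y : E ⊗[ℂ] F) : HilbertTensor E F)) : S = T := by
  refine ContinuousLinearMap.ext fun z => ?_
  induction z using UniformSpace.Completion.induction_on with
  | hp => exact isClosed_eq S.continuous T.continuous
  | ih z =>
    induction z using TensorProduct.induction_on with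
    | zero => rw [UniformSpace.Completion.coe_zero, map_zero, map_zero]
    | tmul x y => exact h x y
    | add z w hz hw => rw [UniformSpace.Completion.coe_add, map_add, map_add, hz, hw]

section Slice
variable {V W : Type} [AddCommGroup V] [Module ℂ V] [AddCommGroup W] [Module ℂ W]

/-- The slice map `v ⊗ w ↦ l(w) v`. -/
def tensorSlice (l : W →ₗ[ℂ] ℂ) : V ⊗[ℂ] W →ₗ[ℂ] V :=
  (TensorProduct.rid ℂ V).toLinearMap ∘ₗ l.lTensor V

theorem tensorSlice_tmul (l : W →ₗ[ℂ] ℂ) (v : V) (w : W) :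
    tensorSlice l (v ⊗ₜ w) = l w • v := by simp [tensorSlice]

open Classical in
theorem eq_zero_of_tensorSlice (L : Set (W →ₗ[ℂ] ℂ)) (hL : ∀ w, (∀ l ∈ L, l w = 0) → w = 0)
    (X : V ⊗[ℂ] W) (hX : ∀ l ∈ L, tensorSlice l X = 0) : X = 0 := by
  let b := Module.Basis.ofVectorSpace ℂ V
  have h2 : ∀ (Y : V ⊗[ℂ] W) (l : W →ₗ[ℂ] ℂ) i,
      b.repr (tensorSlice l Y) i = l (TensorProduct.equivFinsuppOfBasisLeft b Y i) := by
    intro Y l i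
    induction Y using TensorProduct.induction_on with
    | zero => simp
    | tmul B A => simp [tensorSlice_tmul, mul_comm]
    | add Y Z hY hZ => simp only [map_add, Finsupp.add_apply, hY, hZ]
  refine (TensorProduct.equivFinsuppOfBasisLeft b).injective ?_
  rw [map_zero]
  ext1 i
  refine hL _ fun l hl => ?_
  rw [← h2, hX l hl]
  simp
end Slice

section Observables
variable (ι κ : Type) [LinearOrder ι] [LinearOrder κ]

/-- The map `B ⊗ A ↦ B ⊗ A` from the algebraic tensor product of the two CAR algebras to the
operators on the Hilbert tensor product of the two Fock spaces. It is injective. If `κ` is finite,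
the second algebra is finite dimensional and the algebraic tensor product is already the tensor
product of C*-algebras. -/
def represent : carAlgebra ι ⊗[ℂ] carAlgebra κ →ₗ[ℂ] Op (HilbertTensor (Fock ι) (Fock κ)) :=
  TensorProduct.lift <| LinearMap.mk₂ ℂ
    (fun (B : carAlgebra ι) (A : carAlgebra κ) => opTensor (B : Op (Fock ι)) (A : Op (Fock κ)))
    (fun B B' A => op_ext fun x y => by
      simp [opTensor_coe, TensorProduct.add_tmul, UniformSpace.Completion.coe_add])
    (fun c B A => op_ext fun x y => by
      rw [smul_apply, opTensor_coe, opTensor_coe, ← UniformSpace.Completion.coe_smul]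
      exact congrArg _ (TensorProduct.smul_tmul' c _ _).symm)
    (fun B A A' => op_ext fun x y => by
      simp [opTensor_coe, TensorProduct.tmul_add, UniformSpace.Completion.coe_add])
    (fun c B A => op_ext fun x y => by
      simp [opTensor_coe, TensorProduct.tmul_smul, UniformSpace.Completion.coe_smul])

variable {ι κ}

theorem represent_tmul (B : carAlgebra ι) (A : carAlgebra κ) :
    represent ι κ (B ⊗ₜ A) = opTensor (B : Op (Fock ι)) (A : Op (Fock κ)) := rfl

/-- The functional `A ↦ ⟨f, A g⟩`. -/
def matrixElement (f g : Fock κ) : carAlgebra κ →ₗ[ℂ] ℂ where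
  toFun A := inner ℂ f ((A : Op (Fock κ)) g)
  map_add' A A' := by simp [inner_add_right]
  map_smul' c A := by simp [inner_smul_right]

theorem inner_represent (X : carAlgebra ι ⊗[ℂ] carAlgebra κ) (x y : Fock ι) (f g : Fock κ) :
    inner ℂ ((x ⊗ₜ[ℂ] f : Fock ι ⊗[ℂ] Fock κ) : HilbertTensor (Fock ι) (Fock κ))
      (represent ι κ X ((y ⊗ₜ[ℂ] g : Fock ι ⊗[ℂ] Fock κ) : HilbertTensor (Fock ι) (Fock κ))) =
    inner ℂ x (((tensorSlice (matrixElement f g) X : carAlgebra ι) : Op (Fock ι)) y) := by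
  induction X using TensorProduct.induction_on with
  | zero =>
    rw [map_zero, map_zero, ZeroMemClass.coe_zero, zero_apply, zero_apply, inner_zero_right,
      inner_zero_right]
  | tmul B A =>
    rw [represent_tmul, opTensor_coe, UniformSpace.Completion.inner_coe, tensorSlice_tmul,
      TensorProduct.inner_tmul, mul_comm]
    exact (inner_smul_right _ _ _).symm
  | add X Y hX hY =>
    have h1 : represent ι κ (X + Y) = represent ι κ X + represent ι κ Y := map_add _ _ _
    have h2 : tensorSlice (matrixElement f g) (X + Y) = tensorSlice (matrixElement f g) X +
      tensorSlice (matrixElement f g) Y := map_add _ _ _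
    rw [h1, h2, add_apply, inner_add_right]
    exact (congrArg₂ (· + ·) hX hY).trans (inner_add_right x _ _).symm

theorem represent_injective : Function.Injective (represent ι κ) := by
  rw [← LinearMap.ker_eq_bot, LinearMap.ker_eq_bot']
  intro X hX
  refine eq_zero_of_tensorSlice (Set.range fun p : Fock κ × Fock κ => matrixElement p.1 p.2)
    (fun A hA => ?_) X ?_
  · exact Subtype.ext (ContinuousLinearMap.ext fun g => ext_inner_left ℂ fun f =>
      (hA _ ⟨(f, g), rfl⟩).trans (inner_zero_right f).symm)
  · rintro _ ⟨⟨f, g⟩, rfl⟩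
    refine Subtype.ext (ContinuousLinearMap.ext fun y => ext_inner_left ℂ fun x => ?_)
    rw [← inner_represent, hX, zero_apply, inner_zero_right]
    exact (inner_zero_right x).symm

variable (ι κ) in
/-- The observables of the composite system, as operators on the total Fock space. -/
def observables : Submodule ℂ (Op (HilbertTensor (Fock ι) (Fock κ))) :=
  LinearMap.range (represent ι κ)

/-- The map `ω ⊗ id`, i.e. `B ⊗ A ↦ ω(B) A`. -/
def partialState (ω : carAlgebra ι →ₗ[ℂ] ℂ) : carAlgebra ι ⊗[ℂ] carAlgebra κ →ₗ[ℂ] Op (Fock κ) :=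
  TensorProduct.lift <| LinearMap.mk₂ ℂ
    (fun (B : carAlgebra ι) (A : carAlgebra κ) => ω B • (A : Op (Fock κ)))
    (fun B B' A => by simp [add_smul]) (fun c B A => by simp [mul_smul])
    (fun B A A' => smul_add _ _ _) (fun c B A => smul_comm _ _ _)

open Classical in
/-- The partial expectation `ω(T)`, an operator on the second Fock space, of an observable `T` of
the composite system: it is `(ω ⊗ id)(X)` if `T` is represented by `X`
(`partialExpectation_represent`). It is set to `0` if `T` is not an observable. -/
def partialExpectation (ω : carAlgebra ι →ₗ[ℂ] ℂ) (T : Op (HilbertTensor (Fock ι) (Fock κ))) :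
    Op (Fock κ) :=
  if h : T ∈ observables ι κ then
    partialState ω ((LinearEquiv.ofInjective (represent ι κ) represent_injective).symm ⟨T, h⟩)
  else 0

theorem partialExpectation_represent (ω : carAlgebra ι →ₗ[ℂ] ℂ)
    (X : carAlgebra ι ⊗[ℂ] carAlgebra κ) :
    partialExpectation ω (represent ι κ X) = partialState ω X := by
  have h : represent ι κ X ∈ observables ι κ := LinearMap.mem_range_self _ X
  rw [partialExpectation, dif_pos h]
  congr 1
  exact (LinearEquiv.symm_apply_eq _).2 (Subtype.ext rfl)

end Observables

theorem annihilation_mem {ι : Type} [LinearOrder ι] (φ : OneParticle ι) :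
    annihilation φ ∈ carAlgebra ι :=
  StarSubalgebra.le_topologicalClosure _ (StarAlgebra.subset_adjoin ℂ _ ⟨φ, rfl⟩)

/-- The annihilation operator `c(φ)` as an element of the CAR algebra. -/
def algAnnihilation {ι : Type} [LinearOrder ι] (φ : OneParticle ι) : carAlgebra ι :=
  ⟨annihilation φ, annihilation_mem φ⟩

/-- `ω` is the gauge-invariant quasi-free state with density `D` on the CAR algebra: a state with
`ω(c*(φ_m) ... c*(φ_1) c(ψ_1) ... c(ψ_n)) = δ_{nm} det (⟨ψ_j, D φ_k⟩)`. -/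
structure IsQuasiFreeState {ι : Type} [LinearOrder ι] (D : Op (OneParticle ι))
    (ω : carAlgebra ι →ₗ[ℂ] ℂ) : Prop where
  map_one : ω 1 = 1
  nonneg : ∀ A : carAlgebra ι, (ω (star A * A)).im = 0 ∧ 0 ≤ (ω (star A * A)).re
  correlation : ∀ (n : ℕ) (φ ψ : Fin n → OneParticle ι),
    ω ((List.ofFn fun k => star (algAnnihilation (φ k))).reverse.prod *
        (List.ofFn fun j => algAnnihilation (ψ j)).prod) =
      Matrix.det (Matrix.of fun j k => inner ℂ (ψ j) (D (φ k)))
  gauge : ∀ (m n : ℕ) (φ : Fin m → OneParticle ι) (ψ : Fin n → OneParticle ι), m ≠ n →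
    ω ((List.ofFn fun k => star (algAnnihilation (φ k))).reverse.prod *
        (List.ofFn fun j => algAnnihilation (ψ j)).prod) = 0

section Model
variable (d : ℕ) [NeZero d]

/-- The Fock space of the composite system: reservoir (over `ℓ²(ℤ)`) tensor sample (over
`ℓ²({0, ..., d-1})`). -/
abbrev Total : Type := HilbertTensor (Fock ℤ) (Fock (Fin d))

/-- The reservoir annihilation operator `b_j`. -/
def resA (j : ℤ) : Op (Fock ℤ) := annihilation (site j)
/-- The sample annihilation operator `a_j`. -/
def samA {d : ℕ} (j : Fin d) : Op (Fock (Fin d)) := annihilation (site j)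

/-- The reservoir occupation number `n^r_j = b_j* b_j`. -/
def resN (j : ℤ) : Op (Fock ℤ) := star (resA j) * resA j
/-- The sample occupation number `n^s_j = a_j* a_j`. -/
def samN {d : ℕ} (j : Fin d) : Op (Fock (Fin d)) := star (samA j) * samA j
/-- The number operator `N_s` of the sample. -/
def samTotalN : Op (Fock (Fin d)) := ∑ j : Fin d, samN j

/-- The coupling `K = exp(-iα (b_0* ⊗ a_0 + b_0 ⊗ a_0*))`. -/
def coupling (α : ℝ) : Op (Total d) :=
  NormedSpace.exp ((-(Complex.I * (α : ℂ))) •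
    (opTensor (star (resA 0)) (samA (0 : Fin d)) + opTensor (resA 0) (star (samA (0 : Fin d)))))

/-- The free step `U_F = Γ(S) ⊗ Γ(S_p)`. -/
def freeStep : Op (Total d) :=
  opTensor (secondQuantization (shift ℤ)) (secondQuantization (shift (Fin d)))

/-- The one-step evolution `U = U_F K`. -/
def step (α : ℝ) : Op (Total d) := freeStep d * coupling d α

variable {d} in
/-- The evolution `τ^t(X) = U*^t X U^t`. -/
def evolve (α : ℝ) (t : ℕ) (X : Op (Total d)) : Op (Total d) :=
  star (step d α) ^ t * X * step d α ^ t

/-- The flux observable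
`sin² α (1 ⊗ n^s_0 - n^r_0 ⊗ 1) + i ε sin α cos α (b_0* ⊗ a_0 - b_0 ⊗ a_0*)`, with a sign `ε`
that depends on the convention for the sign of `α` in the coupling. -/
def flux (ε α : ℝ) : Op (Total d) :=
  ((Real.sin α ^ 2 : ℝ) : ℂ) • (opTensor 1 (samN (0 : Fin d)) - opTensor (resN 0) 1) +
    (Complex.I * ((ε * Real.sin α * Real.cos α : ℝ) : ℂ)) •
      (opTensor (star (resA 0)) (samA (0 : Fin d)) - opTensor (resA 0) (star (samA (0 : Fin d))))
end Model
end
end FermiWalk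

open FermiWalk

/-! Reservoir operators commute with sample operators on the tensor product, instead of
anticommuting, so `K* a_0 K` is not a linear combination of `a_0` and `b_0`. Products `X* Y` of two
annihilation operators still evolve linearly in each factor. Let `G` be the generator of the
coupling, `K = exp(-iαG)` and `U_F` the free step. Inserting `U_F U_F* = 1` and `K K* = K* K = 1`
gives `U* X* Y U = (H X)* (H Y)` with `H X = K (U_F* X U_F) K`, where `K` stands on both sides
(`evolve_star_mul`).

For this twisted conjugation it is anticommutators with `G` that matter. Fields away from site 0
anticommute with `G`, and `K X K = X` for them. At site 0 the anticommutator of `G` with `a_0` is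
`b_0` and conversely, which gives `K a_0 K = cos α a_0 - i sin α b_0` (`coupling_samField`).

Hence `H` is a one-particle dynamics: `b_n` moves to `b_{n+1}` for `n ≥ 0` and never comes back,
while `a_j` runs around the cycle and leaks into the reservoir once per turn. After `t = md + u`
steps `a_0` has become `cos^m α a_u + b(φ)` with `‖φ‖² = 1 - cos^{2m} α`, and `b_0` has become
`b_t`, whose mode is orthogonal to `φ` (`exists_halfStep_pow_samField_zero`).

The flux is a combination of such products. Gauge invariance kills the terms with a single reservoir
field, and a pair `b*(φ) b(ψ)` contributes `σ⟨ψ, φ⟩` (`hasPartialExpectation_bilinear`). By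
orthogonality the exchange terms have expectation zero, so `ε` drops out, and there remains `sin² α
(cos^{2m} α n_u + σ(1 - cos^{2m} α) - σ)`. Summed over one turn this is a multiple of `N_s - σd`,
and the sum over turns telescopes because `sin² α = 1 - cos² α`. For `N_s` itself, `a_j = H^j a_0`
reduces everything to the orbit of `a_0`. -/

namespace FermiWalk

/-! ### Algebra of the operators `A ⊗ B`. -/

section OpTensor
variable {E F : Type} [NormedAddCommGroup E] [InnerProductSpace ℂ E]
  [NormedAddCommGroup F] [InnerProductSpace ℂ F]

theorem opTensor_mul (A A' : Op E) (B B' : Op F) :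
    opTensor A B * opTensor A' B' = opTensor (A * A') (B * B') :=
  op_ext fun x y => by
    rw [mul_apply_eq_comp, opTensor_coe, opTensor_coe, opTensor_coe]; rfl

theorem opTensor_one : opTensor (1 : Op E) (1 : Op F) = 1 :=
  op_ext fun x y => by rw [opTensor_coe]; rfl

theorem opTensor_add_left (A A' : Op E) (B : Op F) :
    opTensor (A + A') B = opTensor A B + opTensor A' B :=
  op_ext fun x y => by
    simp [opTensor_coe, TensorProduct.add_tmul, UniformSpace.Completion.coe_add]

theorem opTensor_add_right (A : Op E) (B B' : Op F) :
    opTensor A (B + B') = opTensor A B + opTensor A B' :=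
  op_ext fun x y => by
    simp [opTensor_coe, TensorProduct.tmul_add, UniformSpace.Completion.coe_add]

theorem opTensor_smul_left (c : ℂ) (A : Op E) (B : Op F) :
    opTensor (c • A) B = c • opTensor A B :=
  op_ext fun x y => by
    rw [smul_apply, opTensor_coe, opTensor_coe,
      ← UniformSpace.Completion.coe_smul]
    exact congrArg _ (TensorProduct.smul_tmul' c _ _).symm

theorem opTensor_smul_right (c : ℂ) (A : Op E) (B : Op F) :
    opTensor A (c • B) = c • opTensor A B :=
  op_ext fun x y => by
    simp [opTensor_coe, TensorProduct.tmul_smul, UniformSpace.Completion.coe_smul]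

theorem opTensor_zero_left (B : Op F) : opTensor (0 : Op E) B = 0 := by
  simpa using opTensor_smul_left (0 : ℂ) (0 : Op E) B

theorem opTensor_zero_right (A : Op E) : opTensor A (0 : Op F) = 0 := by
  simpa using opTensor_smul_right (0 : ℂ) A (0 : Op F)

theorem opTensor_neg_left (A : Op E) (B : Op F) : opTensor (-A) B = -opTensor A B := by
  simpa using opTensor_smul_left (-1 : ℂ) A B

theorem opTensor_neg_right (A : Op E) (B : Op F) : opTensor A (-B) = -opTensor A B := by
  simpa using opTensor_smul_right (-1 : ℂ) A B

theorem opTensor_sum_right {κ : Type*} (s : Finset κ) (A : Op E) (B : κ → Op F) :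
    opTensor A (∑ i ∈ s, B i) = ∑ i ∈ s, opTensor A (B i) := by
  classical
  induction s using Finset.induction_on with
  | empty => simp [opTensor_zero_right]
  | insert i s hi ih => rw [Finset.sum_insert hi, Finset.sum_insert hi, opTensor_add_right, ih]

theorem star_opTensor [CompleteSpace E] [CompleteSpace F] (A : Op E) (B : Op F) :
    star (opTensor A B) = opTensor (star A) (star B) := by
  refine op_ext fun x y => ext_inner_left ℂ fun z => ?_
  rw [ContinuousLinearMap.star_eq_adjoint, ContinuousLinearMap.adjoint_inner_right]
  induction z using UniformSpace.Completion.induction_on with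
  | hp =>
    exact isClosed_eq ((opTensor A B).continuous.inner continuous_const)
      (continuous_id.inner continuous_const)
  | ih z =>
    induction z using TensorProduct.induction_on with
    | zero =>
      rw [UniformSpace.Completion.coe_zero, map_zero, inner_zero_left, inner_zero_left]
    | tmul u v =>
      rw [opTensor_coe, opTensor_coe, UniformSpace.Completion.inner_coe,
        UniformSpace.Completion.inner_coe, TensorProduct.inner_tmul, TensorProduct.inner_tmul,
        ContinuousLinearMap.star_eq_adjoint, ContinuousLinearMap.star_eq_adjoint,
        ContinuousLinearMap.adjoint_inner_right, ContinuousLinearMap.adjoint_inner_right]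
    | add z w hz hw =>
      rw [UniformSpace.Completion.coe_add, map_add, inner_add_left, inner_add_left, hz, hw]

end OpTensor

/-! ### The exponential of an element with `G³ = G`. -/

section Exponential
variable {𝔸 : Type*} [NormedRing 𝔸] [NormedAlgebra ℂ 𝔸] [CompleteSpace 𝔸]

/-- The exponential of a multiple of an element with spectrum in `{-1, 0, 1}`. -/
theorem exp_smul_of_cube_eq {G : 𝔸} (hG : G * G * G = G) (z : ℂ) :
    NormedSpace.exp (z • G) = 1 + (Complex.cosh z - 1) • (G * G) + Complex.sinh z • G := by
  -- Spectral decomposition: `1 - G²` and `(G² ± G)/2` are the projections for the eigenvalues `0`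
  -- and `±1`. The coefficient `0 ^ n` is `1` at `n = 0`, which makes the formula valid there as
  -- well.
  have hpow : ∀ n : ℕ, G ^ n = (0 : ℂ) ^ n • (1 - G * G) + (2⁻¹ : ℂ) • (G * G + G) +
      ((-1) ^ n * 2⁻¹ : ℂ) • (G * G - G) := by
    have h1 : ∀ n : ℕ, G ^ (n + 1) = (2⁻¹ : ℂ) • (G * G + G) +
        ((-1) ^ (n + 1) * 2⁻¹ : ℂ) • (G * G - G) := by
      intro n
      induction n with
      | zero => rw [zero_add, pow_one]; module
      | succ n ih =>
        rw [pow_succ, ih, add_mul, smul_mul_assoc, smul_mul_assoc, add_mul, sub_mul, hG,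
          pow_succ _ (n + 1)]
        module
    intro n
    cases n with
    | zero => rw [pow_zero]; module
    | succ n => rw [h1 n, zero_pow n.succ_ne_zero, zero_smul, zero_add]
  have hexp : ∀ w : ℂ, HasSum (fun n : ℕ => (n.factorial⁻¹ : ℂ) * w ^ n) (Complex.exp w) := by
    intro w
    rw [Complex.exp_eq_exp_ℂ]
    simpa using NormedSpace.exp_series_hasSum_exp' (𝕂 := ℂ) w
  have h0 := (hexp 0).smul_const (1 - G * G)
  have h1 := (hexp z).smul_const ((2⁻¹ : ℂ) • (G * G + G))
  have h2 := (hexp (-z)).smul_const ((2⁻¹ : ℂ) • (G * G - G))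
  have h3 := (NormedSpace.exp_series_hasSum_exp' (𝕂 := ℂ) (z • G)).unique
    (((h0.add h1).add h2).congr_fun ?_)
  · rw [h3, Complex.cosh, Complex.sinh, Complex.exp_zero]
    module
  · intro n
    rw [smul_pow, hpow, neg_pow]
    rcases eq_or_ne n 0 with rfl | hn
    · simp only [pow_zero]; module
    · rw [zero_pow hn]; module

end Exponential

/-! ### Second quantization of the shift. -/

section Wedge
variable {ι : Type} [LinearOrder ι]

/-- The scalar is the sign of the permutation. That it is chosen before `v` lets the same sign be
used before and after applying `W`. -/
theorem exists_wedge_eq_smul_of_perm {l l' : List ι} (h : l.Perm l') :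
    ∃ s : ℂ, ∀ v : ι → OneParticle ι, wedge (l.map v) = s • wedge (l'.map v) := by
  induction h with
  | nil => exact ⟨1, fun v => by rw [one_smul]⟩
  | cons a _ ih =>
    obtain ⟨s, hs⟩ := ih
    exact ⟨s, fun v => by rw [List.map_cons, List.map_cons, wedge_cons, wedge_cons, hs, map_smul]⟩
  | swap a b l =>
    refine ⟨-1, fun v => ?_⟩
    simp only [List.map_cons, wedge_cons]
    rw [creation_creation_apply, neg_one_smul]
  | trans _ _ ih ih' =>
    obtain ⟨s, hs⟩ := ih
    obtain ⟨s', hs'⟩ := ih'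
    exact ⟨s * s', fun v => by rw [hs, hs', smul_smul]⟩

/-- `Γ(W)` is defined on increasing wedges only. Arbitrary lists are needed because putting a vector
in front, or translating modulo `d`, destroys the order. -/
theorem secondQuantization_wedge_map_site (W : OneParticle ι →ₗᵢ[ℂ] OneParticle ι) (l : List ι) :
    secondQuantization W (wedge (l.map site)) = wedge (l.map fun j => W (site j)) := by
  by_cases hl : l.Nodup
  · have h : l.Perm (l.toFinset.sort (· ≤ ·)) :=
      (List.perm_of_nodup_nodup_toFinset_eq hl (Finset.sort_nodup _ _) (by simp))
    obtain ⟨s, hs⟩ := exists_wedge_eq_smul_of_perm h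
    rw [hs, hs, map_smul, secondQuantization_wedge_site]
  -- A repeated vector makes both wedges vanish.
  · have h0 : ∀ v : ι → OneParticle ι, wedge (l.map v) = 0 := by
      intro v
      clear * - hl
      induction l with
      | nil => simp at hl
      | cons a l ih =>
        rw [List.map_cons, wedge_cons]
        by_cases ha : a ∈ l
        · exact creation_wedge_of_mem (List.mem_map_of_mem ha)
        · rw [ih fun h => hl (List.nodup_cons.2 ⟨ha, h⟩), map_zero]
    rw [h0, h0, map_zero]

theorem op_fock_ext {A B : Op (Fock ι)}
    (h : ∀ S : Finset ι, A (wedge ((S.sort (· ≤ ·)).map site)) =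
      B (wedge ((S.sort (· ≤ ·)).map site))) : A = B := by
  refine lp.ext_continuousLinearMap (by norm_num) fun S => ContinuousLinearMap.ext_ring ?_
  have h' := h S
  rw [wedge_site] at h'
  exact h'

theorem star_secondQuantization_mul_self (W : OneParticle ι →ₗᵢ[ℂ] OneParticle ι) :
    star (secondQuantization W) * secondQuantization W = 1 := by
  rw [ContinuousLinearMap.star_eq_adjoint]
  exact (ContinuousLinearMap.norm_map_iff_adjoint_comp_self _).1 fun x =>
    (isometryOfOrthonormal (orthonormal_wedge (orthonormal_site.comp_linearIsometry W))).norm_map x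

variable [AddCommGroup ι] [One ι]

/-- An isometry alone gives only `Γ* Γ = 1`. Here each basis wedge lies in the range of `Γ`, being
the image of the wedge of the sites translated by `+1`. -/
theorem secondQuantization_shift_mul_star :
    secondQuantization (shift ι) * star (secondQuantization (shift ι)) = 1 := by
  refine op_fock_ext fun S => ?_
  have h : wedge ((S.sort (· ≤ ·)).map site) = secondQuantization (shift ι)
      (wedge (((S.sort (· ≤ ·)).map (· + 1)).map site)) := by
    rw [secondQuantization_wedge_map_site, List.map_map]
    simp only [Function.comp_def, shift_site, add_sub_cancel_right]
  rw [h]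
  exact congrArg (secondQuantization (shift ι)) (congrArg
    (fun A : Op (Fock ι) => A (wedge (((S.sort (· ≤ ·)).map (· + 1)).map site)))
    (star_secondQuantization_mul_self (shift ι)))

theorem secondQuantization_shift_mul_creation (j : ι) :
    secondQuantization (shift ι) * creation (site (j + 1)) =
      creation (site j) * secondQuantization (shift ι) := by
  refine op_fock_ext fun S => ?_
  rw [mul_apply_eq_comp, mul_apply_eq_comp, ← wedge_cons,
    ← List.map_cons, secondQuantization_wedge_map_site, secondQuantization_wedge_map_site,
    List.map_cons, wedge_cons, shift_site, add_sub_cancel_right]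

theorem secondQuantization_shift_conj_annihilation (j : ι) :
    star (secondQuantization (shift ι)) * annihilation (site j) * secondQuantization (shift ι) =
      annihilation (site (j + 1)) := by
  have h : star (secondQuantization (shift ι)) * creation (site j) *
      secondQuantization (shift ι) = creation (site (j + 1)) := by
    rw [mul_assoc, ← secondQuantization_shift_mul_creation, ← mul_assoc,
      star_secondQuantization_mul_self, one_mul]
  have h' := congrArg star h
  rw [star_mul, star_mul, star_star, ← mul_assoc] at h'
  exact h'

end Wedge
-- Consequences of the anticommutation relations.
section CAR
variable {ι : Type} [LinearOrder ι]

theorem annihilation_anticomm (φ χ : OneParticle ι) :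
    annihilation φ * annihilation χ = -(annihilation χ * annihilation φ) := by
  have h := congrArg star (creation_anticomm φ χ)
  rw [star_add, star_mul, star_mul, star_zero, add_comm] at h
  exact eq_neg_of_add_eq_zero_left h

theorem annihilation_mul_self (φ : OneParticle ι) : annihilation φ * annihilation φ = 0 := by
  have h := annihilation_anticomm φ φ
  rw [eq_neg_iff_add_eq_zero, ← two_smul ℂ, smul_eq_zero] at h
  exact h.resolve_left two_ne_zero

theorem star_annihilation (φ : OneParticle ι) : star (annihilation φ) = creation φ := star_star _

theorem annihilation_site_mul_star (j : ι) :
    annihilation (site j) * star (annihilation (site j)) =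
      1 - star (annihilation (site j)) * annihilation (site j) := by
  rw [star_annihilation, eq_sub_iff_add_eq, annihilation_creation_anticomm,
    orthonormal_iff_ite.1 orthonormal_site]
  simp

theorem annihilation_site_anticomm_star {i j : ι} (h : i ≠ j) :
    annihilation (site i) * star (annihilation (site j)) =
      -(star (annihilation (site j)) * annihilation (site i)) := by
  rw [star_annihilation, eq_neg_iff_add_eq_zero, annihilation_creation_anticomm,
    orthonormal_iff_ite.1 orthonormal_site, if_neg h, zero_smul]

theorem annihilation_site_mul_star_mul_self (j : ι) :
    annihilation (site j) * (star (annihilation (site j)) * annihilation (site j)) =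
      annihilation (site j) := by
  rw [← mul_assoc, annihilation_site_mul_star, sub_mul, one_mul, mul_assoc,
    annihilation_mul_self, mul_zero, sub_zero]

theorem creation_add (φ χ : OneParticle ι) : creation (φ + χ) = creation φ + creation χ := by
  refine (hasSum_creation (φ + χ)).unique ?_
  simpa [add_smul] using (hasSum_creation φ).add (hasSum_creation χ)

theorem creation_smul (c : ℂ) (φ : OneParticle ι) : creation (c • φ) = c • creation φ := by
  refine (hasSum_creation (c • φ)).unique ?_
  simpa [mul_smul] using (hasSum_creation φ).const_smul c

theorem annihilation_add (φ χ : OneParticle ι) :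
    annihilation (φ + χ) = annihilation φ + annihilation χ := by
  rw [annihilation, creation_add, star_add]; rfl

theorem annihilation_smul (c : ℂ) (φ : OneParticle ι) :
    annihilation (c • φ) = conj c • annihilation φ := by
  rw [annihilation, creation_smul, star_smul]; rfl

theorem annihilation_zero : annihilation (0 : OneParticle ι) = 0 := by
  simpa using annihilation_smul (0 : ℂ) (0 : OneParticle ι)

end CAR

section Model
variable {d : ℕ}

theorem samA_mul_self (j : Fin d) : samA j * samA j = 0 := annihilation_mul_self _
theorem resA_mul_self (j : ℤ) : resA j * resA j = 0 := annihilation_mul_self _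
theorem star_samA_mul_self (j : Fin d) : star (samA j) * star (samA j) = 0 := by
  rw [← star_mul, samA_mul_self, star_zero]
theorem samA_mul_star_mul_self (j : Fin d) : samA j * (star (samA j) * samA j) = samA j :=
  annihilation_site_mul_star_mul_self j
theorem resA_mul_star_mul_self (j : ℤ) : resA j * (star (resA j) * resA j) = resA j :=
  annihilation_site_mul_star_mul_self j
theorem star_samA_mul_mul_star (j : Fin d) :
    star (samA j) * (samA j * star (samA j)) = star (samA j) := by
  simpa [mul_assoc] using congrArg star (samA_mul_star_mul_self j)
theorem star_resA_mul_mul_star (j : ℤ) :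
    star (resA j) * (resA j * star (resA j)) = star (resA j) := by
  simpa [mul_assoc] using congrArg star (resA_mul_star_mul_self j)

end Model

/-! ### Two-sided multiplication by the coupling as a rotation. -/

section Rotation
variable {A : Type*} [Ring A] [Algebra ℂ A]

/-- Every term beyond first order in `G` contains `G a G = 0`, except `G² a + a G²`. Multiplying `b
= G a + a G` by `G` turns the latter into `G b + b G = a`. -/
theorem rotation_conj {G a b : A} (h0 : G * a * G = 0) (h1 : G * a + a * G = b)
    (h2 : G * b + b * G = a) (x y : ℂ) :
    (1 + x • (G * G) + y • G) * a * (1 + x • (G * G) + y • G) = (1 + x) • a + y • b := by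
  have h3 : G * G * a + a * (G * G) = a := by
    have h4 : G * G * a = G * b := by
      rw [← h1, mul_add, ← mul_assoc, ← mul_assoc, h0, add_zero]
    have h5 : a * (G * G) = b * G := by
      rw [← h1, add_mul, h0, zero_add, mul_assoc]
    rw [h4, h5, h2]
  have h6 : (1 + x • (G * G) + y • G) * a * (1 + x • (G * G) + y • G) =
      a + x • (G * G * a + a * (G * G)) + y • (G * a + a * G) +
      (x * x) • (G * (G * a * G) * G) + (x * y) • (G * (G * a * G) + G * a * G * G) +
      (y * y) • (G * a * G) := by
    simp only [add_mul, mul_add, smul_mul_assoc, mul_smul_comm, one_mul, mul_one, mul_assoc,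
      smul_add, mul_smul]
    module
  rw [h6, h3, h1, h0]
  simp only [mul_zero, zero_mul, smul_zero, add_zero]
  module

end Rotation

/-! ### The one-particle dynamics of the fields. -/

section Dynamics
variable {d : ℕ} [NeZero d]

variable (d) in
/-- The generator `b_0* ⊗ a_0 + b_0 ⊗ a_0*` of the coupling. -/
noncomputable def exchange : Op (Total d) :=
  opTensor (star (resA 0)) (samA (0 : Fin d)) + opTensor (resA 0) (star (samA (0 : Fin d)))

/-- The operator `c(φ) ⊗ 1` of the composite system. -/
noncomputable def resField (d : ℕ) [NeZero d] (φ : OneParticle ℤ) : Op (Total d) :=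
  opTensor (annihilation φ) 1

/-- The operator `1 ⊗ a_j` of the composite system. -/
noncomputable def samField (j : Fin d) : Op (Total d) := opTensor 1 (samA j)

theorem resField_add (φ χ : OneParticle ℤ) :
    resField d (φ + χ) = resField d φ + resField d χ := by
  rw [resField, annihilation_add, opTensor_add_left]; rfl

theorem resField_smul (c : ℂ) (φ : OneParticle ℤ) :
    resField d (c • φ) = conj c • resField d φ := by
  rw [resField, annihilation_smul, opTensor_smul_left]; rfl

theorem resField_zero : resField d 0 = 0 := by
  rw [resField, annihilation_zero, opTensor_zero_left]

theorem star_exchange : star (exchange d) = exchange d := by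
  rw [exchange, star_add, star_opTensor, star_opTensor, star_star, star_star, add_comm]

theorem exchange_mul_self : exchange d * exchange d =
    opTensor (star (resA 0) * resA 0) (samA (0 : Fin d) * star (samA (0 : Fin d))) +
      opTensor (resA 0 * star (resA 0)) (star (samA (0 : Fin d)) * samA (0 : Fin d)) := by
  rw [exchange, add_mul, mul_add, mul_add]
  simp only [opTensor_mul, samA_mul_self, star_samA_mul_self, opTensor_zero_right]
  abel

/-- `G²` is the projection onto the states with exactly one of the two sites 0 occupied, and `G`
exchanges these two occupations. -/
theorem exchange_cube : exchange d * exchange d * exchange d = exchange d := by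
  rw [mul_assoc, exchange_mul_self, exchange, add_mul, mul_add, mul_add]
  simp only [opTensor_mul, ← mul_assoc, samA_mul_self, star_samA_mul_self, zero_mul,
    opTensor_zero_right]
  simp only [mul_assoc, samA_mul_star_mul_self, resA_mul_star_mul_self, star_samA_mul_mul_star,
    star_resA_mul_mul_star]
  abel

theorem coupling_eq (α : ℝ) : coupling d α =
    1 + (Complex.cos α - 1) • (exchange d * exchange d) +
      (-(Complex.I * Complex.sin α)) • exchange d := by
  have h := exp_smul_of_cube_eq (exchange_cube (d := d)) (-(Complex.I * (α : ℂ)))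
  rw [coupling, ← exchange, h, Complex.cosh_neg, Complex.sinh_neg, mul_comm Complex.I,
    Complex.cosh_mul_I, Complex.sinh_mul_I, mul_comm Complex.I]

theorem coupling_mem_unitary (α : ℝ) : coupling d α ∈ unitary (Op (Total d)) := by
  rw [coupling, ← exchange]
  let _ : NormedAlgebra ℚ (Op (Total d)) := NormedAlgebra.restrictScalars ℚ ℂ _
  refine NormedSpace.exp_mem_unitary_of_mem_skewAdjoint ?_
  rw [skewAdjoint.mem_iff, star_smul, star_exchange, ← neg_smul]
  simp

/-- `X` commutes with `G²` and changes the sign of `G`, so it carries `K` to `K*`: `X K = K* X`.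
Unitarity of `K` concludes. -/
theorem coupling_mul_mul_of_anticomm (α : ℝ) {X : Op (Total d)}
    (hX : X * exchange d = -(exchange d * X)) : coupling d α * X * coupling d α = X := by
  have hs : star (coupling d α) = 1 + (Complex.cos α - 1) • (exchange d * exchange d) +
      (Complex.I * Complex.sin α) • exchange d := by
    rw [coupling_eq]
    simp only [star_add, star_one, star_smul, star_mul, star_exchange]
    simp [← Complex.cos_conj, ← Complex.sin_conj]
  have h : X * coupling d α = star (coupling d α) * X := by
    have h2 : X * (exchange d * exchange d) = exchange d * exchange d * X := by
      rw [← mul_assoc, hX, neg_mul, mul_assoc, hX, mul_neg, neg_neg, mul_assoc]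
    rw [hs, coupling_eq]
    simp only [mul_add, add_mul, mul_smul_comm, smul_mul_assoc, h2, hX, mul_one, one_mul,
      smul_neg, neg_smul, mul_neg, neg_neg]
  rw [mul_assoc, h, ← mul_assoc, Unitary.mul_star_self_of_mem (coupling_mem_unitary α), one_mul]

theorem exchange_samField :
    exchange d * samField 0 + samField 0 * exchange d = resField d (site 0) := by
  rw [exchange, samField, add_mul, mul_add]
  simp only [opTensor_mul, samA_mul_self, opTensor_zero_right, mul_one, one_mul, zero_add]
  rw [← opTensor_add_right, samA, annihilation_site_mul_star, add_sub_cancel]; rfl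

theorem exchange_resField :
    exchange d * resField d (site 0) + resField d (site 0) * exchange d = samField 0 := by
  have h : resField d (site 0) = opTensor (resA 0) 1 := rfl
  rw [exchange, h, add_mul, mul_add]
  simp only [opTensor_mul, resA_mul_self, opTensor_zero_left, mul_one, one_mul, add_zero]
  rw [← opTensor_add_left, resA, annihilation_site_mul_star, add_sub_cancel]; rfl

theorem exchange_samField_exchange : exchange d * samField 0 * exchange d = 0 := by
  rw [exchange, samField, add_mul, mul_add, add_mul, add_mul]
  simp only [opTensor_mul, mul_one, samA_mul_self, resA_mul_self,
    mul_assoc, mul_zero, zero_mul, opTensor_zero_right, opTensor_zero_left,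
    add_zero]

theorem coupling_samField (α : ℝ) : coupling d α * samField 0 * coupling d α =
    Complex.cos α • samField 0 + (-(Complex.I * Complex.sin α)) • resField d (site 0) := by
  rw [coupling_eq, rotation_conj exchange_samField_exchange exchange_samField exchange_resField,
    add_sub_cancel]

theorem samField_anticomm {j : Fin d} (hj : j ≠ 0) :
    samField j * exchange d = -(exchange d * samField j) := by
  have h1 : samA j * samA (0 : Fin d) = -(samA (0 : Fin d) * samA j) := annihilation_anticomm _ _
  have h2 : samA j * star (samA (0 : Fin d)) = -(star (samA (0 : Fin d)) * samA j) :=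
    annihilation_site_anticomm_star hj
  rw [exchange, samField, mul_add, add_mul]
  simp only [opTensor_mul, one_mul, mul_one, h1, h2, opTensor_neg_right, neg_add]

theorem resField_anticomm {j : ℤ} (hj : j ≠ 0) :
    resField d (site j) * exchange d = -(exchange d * resField d (site j)) := by
  have h1 : resA j * resA 0 = -(resA 0 * resA j) := annihilation_anticomm _ _
  have h2 : resA j * star (resA 0) = -(star (resA 0) * resA j) :=
    annihilation_site_anticomm_star hj
  have h : resField d (site j) = opTensor (resA j) 1 := rfl
  rw [exchange, h, mul_add, add_mul]
  simp only [opTensor_mul, one_mul, mul_one, h1, h2, opTensor_neg_left, neg_add]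

theorem freeStep_mul_star_self : freeStep d * star (freeStep d) = 1 := by
  rw [freeStep, star_opTensor, opTensor_mul, secondQuantization_shift_mul_star,
    secondQuantization_shift_mul_star, opTensor_one]

theorem freeStep_samField (j : Fin d) :
    star (freeStep d) * samField j * freeStep d = samField (j + 1) := by
  rw [freeStep, star_opTensor, samField, opTensor_mul, opTensor_mul, mul_one,
    star_secondQuantization_mul_self, samA, secondQuantization_shift_conj_annihilation]; rfl

theorem freeStep_resField (j : ℤ) :
    star (freeStep d) * resField d (site j) * freeStep d = resField d (site (j + 1)) := by
  rw [freeStep, star_opTensor, resField, opTensor_mul, opTensor_mul, mul_one,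
    star_secondQuantization_mul_self, secondQuantization_shift_conj_annihilation]; rfl

variable (d) in
/-- The map `X ↦ K (U_F* X U_F) K`, where `K` is the coupling and `U_F` the free step. It acts
linearly on the annihilation operators, and it factorizes the evolution of bilinear observables:
see `evolve_star_mul`. -/
noncomputable def halfStep (α : ℝ) : Module.End ℂ (Op (Total d)) :=
  LinearMap.mulLeft ℂ (coupling d α * star (freeStep d)) ∘ₗ
    LinearMap.mulRight ℂ (freeStep d * coupling d α)

theorem halfStep_apply (α : ℝ) (X : Op (Total d)) : halfStep d α X =
    coupling d α * (star (freeStep d) * X * freeStep d) * coupling d α := by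
  simp [halfStep, mul_assoc]

theorem evolve_star_mul (α : ℝ) (t : ℕ) (X Y : Op (Total d)) :
    evolve α t (star X * Y) = star ((halfStep d α ^ t) X) * (halfStep d α ^ t) Y := by
  induction t generalizing X Y with
  | zero => simp [evolve]
  | succ t ih =>
    rw [pow_succ, Module.End.mul_apply, Module.End.mul_apply, ← ih]
    rw [evolve, evolve, pow_succ, pow_succ']
    suffices h : star (step d α) * (star X * Y) * step d α =
        star (halfStep d α X) * halfStep d α Y by
      rw [← h]; simp only [mul_assoc]
    have hK := Unitary.star_mul_self_of_mem (coupling_mem_unitary (d := d) α)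
    have hF := freeStep_mul_star_self (d := d)
    rw [halfStep_apply, halfStep_apply, step]
    simp only [star_mul, star_star, mul_assoc]
    -- Read from right to left: between `X*` and `Y` stand `U_F K* K U_F*`, which collapse to `1`.
    rw [← mul_assoc (star (coupling d α)) (coupling d α), hK, one_mul,
      ← mul_assoc (freeStep d) (star (freeStep d)), hF, one_mul]

/-- The restriction to `n ≥ 0` guarantees that the mode reached is not the coupled site 0. -/
theorem halfStep_resField (α : ℝ) (n : ℕ) :
    halfStep d α (resField d (site (n : ℤ))) = resField d (site ((n + 1 : ℕ) : ℤ)) := by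
  rw [halfStep_apply, freeStep_resField, Nat.cast_succ]
  exact coupling_mul_mul_of_anticomm α (resField_anticomm (by omega))

theorem halfStep_pow_resField (α : ℝ) (n k : ℕ) :
    (halfStep d α ^ n) (resField d (site (k : ℤ))) = resField d (site ((n + k : ℕ) : ℤ)) := by
  induction n with
  | zero => simp
  | succ n ih =>
    rw [pow_succ', Module.End.mul_apply, ih, halfStep_resField, Nat.add_right_comm]

theorem halfStep_samField {j : Fin d} (α : ℝ) (hj : j + 1 ≠ 0) :
    halfStep d α (samField j) = samField (j + 1) := by
  rw [halfStep_apply, freeStep_samField]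
  exact coupling_mul_mul_of_anticomm α (samField_anticomm hj)

theorem halfStep_samField_last {j : Fin d} (α : ℝ) (hj : j + 1 = 0) :
    halfStep d α (samField j) =
      Complex.cos α • samField 0 + (-(Complex.I * Complex.sin α)) • resField d (site 0) := by
  rw [halfStep_apply, freeStep_samField, hj, coupling_samField]

theorem ofNat_add_one (n : ℕ) : Fin.ofNat d n + 1 = Fin.ofNat d (n + 1) := by
  apply Fin.ext
  simp [Fin.ofNat, Fin.val_add]

theorem halfStep_pow_samField (α : ℝ) {u k : ℕ} (h : u + k < d) :
    (halfStep d α ^ k) (samField (Fin.ofNat d u)) = samField (Fin.ofNat d (u + k)) := by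
  induction k with
  | zero => simp
  | succ k ih =>
    rw [pow_succ', Module.End.mul_apply, ih (by omega), halfStep_samField, ofNat_add_one]
    · rfl
    · rw [ofNat_add_one, Ne, Fin.ext_iff]
      simp only [Fin.ofNat, Nat.mod_eq_of_lt (show u + k + 1 < d by omega)]
      simp

/-- One turn of the cycle: `k = d - 1 - u` free steps reach the last site, one step passes site 0
and mixes with `b_0`, and `u` free steps bring `a_0` to `a_u` and `b_0` to `b_u`. -/
theorem halfStep_pow_card_samField (α : ℝ) {u : ℕ} (h : u < d) :
    (halfStep d α ^ d) (samField (Fin.ofNat d u)) = Complex.cos α • samField (Fin.ofNat d u) +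
      (-(Complex.I * Complex.sin α)) • resField d (site (u : ℤ)) := by
  obtain ⟨k, hk⟩ : ∃ k, d = u + (k + 1) := ⟨d - u - 1, by omega⟩
  have hlast : Fin.ofNat d (u + k) + 1 = 0 := by
    rw [ofNat_add_one]
    apply Fin.ext
    simp [Fin.ofNat, show u + k + 1 = d by omega]
  have h0 := halfStep_pow_samField (d := d) α (u := 0) (k := u) (by omega)
  have h1 := halfStep_pow_resField (d := d) α u 0
  have h2 : halfStep d α ^ d = halfStep d α ^ u * (halfStep d α * halfStep d α ^ k) := by
    rw [← pow_succ', ← pow_add, ← hk]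
  rw [zero_add] at h0
  rw [h2, Module.End.mul_apply, Module.End.mul_apply, halfStep_pow_samField α (by omega),
    halfStep_samField_last α hlast, map_add, map_smul, map_smul]
  exact congrArg₂ (fun X Y => Complex.cos α • X + (-(Complex.I * Complex.sin α)) • Y) h0 h1

end Dynamics
-- Partial expectations and the quasi-free state.
section Expectation
variable {ι κ : Type} [LinearOrder ι] [LinearOrder κ]

/-- `T` is an observable with partial expectation `A`. -/
def HasPartialExpectation (ω : carAlgebra ι →ₗ[ℂ] ℂ) (T : Op (HilbertTensor (Fock ι) (Fock κ)))
    (A : Op (Fock κ)) : Prop :=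
  ∃ X : carAlgebra ι ⊗[ℂ] carAlgebra κ, represent ι κ X = T ∧ partialState ω X = A

variable {ω : carAlgebra ι →ₗ[ℂ] ℂ} {S T : Op (HilbertTensor (Fock ι) (Fock κ))}
  {A B : Op (Fock κ)}

/-- Since `partialExpectation` has the default value `0` off the observables, membership and value
are propagated together through the relation and separated only at the end. -/
theorem HasPartialExpectation.mem (h : HasPartialExpectation ω T A) : T ∈ observables ι κ := by
  obtain ⟨X, rfl, -⟩ := h
  exact LinearMap.mem_range_self _ X

theorem HasPartialExpectation.eq (h : HasPartialExpectation ω T A) :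
    partialExpectation ω T = A := by
  obtain ⟨X, rfl, rfl⟩ := h
  exact partialExpectation_represent ω X

theorem HasPartialExpectation.add (h : HasPartialExpectation ω S A)
    (h' : HasPartialExpectation ω T B) : HasPartialExpectation ω (S + T) (A + B) := by
  obtain ⟨X, rfl, rfl⟩ := h
  obtain ⟨Y, rfl, rfl⟩ := h'
  exact ⟨X + Y, map_add _ _ _, map_add _ _ _⟩

theorem HasPartialExpectation.sub (h : HasPartialExpectation ω S A)
    (h' : HasPartialExpectation ω T B) : HasPartialExpectation ω (S - T) (A - B) := by
  obtain ⟨X, rfl, rfl⟩ := h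
  obtain ⟨Y, rfl, rfl⟩ := h'
  exact ⟨X - Y, map_sub _ _ _, map_sub _ _ _⟩

theorem HasPartialExpectation.smul (c : ℂ) (h : HasPartialExpectation ω T A) :
    HasPartialExpectation ω (c • T) (c • A) := by
  obtain ⟨X, rfl, rfl⟩ := h
  exact ⟨c • X, map_smul _ _ _, map_smul _ _ _⟩

theorem HasPartialExpectation.sum {β : Type*} (s : Finset β)
    {T : β → Op (HilbertTensor (Fock ι) (Fock κ))} {A : β → Op (Fock κ)}
    (h : ∀ i ∈ s, HasPartialExpectation ω (T i) (A i)) :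
    HasPartialExpectation ω (∑ i ∈ s, T i) (∑ i ∈ s, A i) := by
  classical
  induction s using Finset.induction_on with
  | empty => exact ⟨0, map_zero _, map_zero _⟩
  | insert i s hi ih =>
    rw [Finset.sum_insert hi, Finset.sum_insert hi]
    exact (h i (Finset.mem_insert_self i s)).add
      (ih fun j hj => h j (Finset.mem_insert_of_mem hj))

theorem hasPartialExpectation_opTensor (ω : carAlgebra ι →ₗ[ℂ] ℂ) (B : carAlgebra ι)
    (A : carAlgebra κ) :
    HasPartialExpectation ω (opTensor (B : Op (Fock ι)) (A : Op (Fock κ)))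
      (ω B • (A : Op (Fock κ))) :=
  ⟨B ⊗ₜ A, rfl, by simp [partialState]⟩

variable {D : Op (OneParticle ι)}

theorem IsQuasiFreeState.annihilation_eq_zero (hω : IsQuasiFreeState D ω) (φ : OneParticle ι) :
    ω (algAnnihilation φ) = 0 := by
  simpa using hω.gauge 0 1 (fun _ => 0) (fun _ => φ) (by norm_num)

theorem IsQuasiFreeState.creation_eq_zero (hω : IsQuasiFreeState D ω) (φ : OneParticle ι) :
    ω (star (algAnnihilation φ)) = 0 := by
  simpa using hω.gauge 1 0 (fun _ => φ) (fun _ => 0) (by norm_num)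

theorem IsQuasiFreeState.two_point (hω : IsQuasiFreeState D ω) (φ ψ : OneParticle ι) :
    ω (star (algAnnihilation φ) * algAnnihilation ψ) = inner ℂ ψ (D φ) := by
  simpa using hω.correlation 1 (fun _ => φ) (fun _ => ψ)

end Expectation

/-! ### Expectations of the flux and of the number operator. -/

section Model
variable {d : ℕ} [NeZero d] {ω : carAlgebra ℤ →ₗ[ℂ] ℂ} {σ : ℝ}

/-- Of the four terms of the product, the two mixed ones contain one reservoir field and vanish by
gauge invariance; the pure reservoir term is the two-point function. -/
theorem hasPartialExpectation_bilinear
    (hω : IsQuasiFreeState ((σ : ℂ) • (1 : Op (OneParticle ℤ))) ω) (x y : ℂ) (i j : Fin d)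
    (φ ψ : OneParticle ℤ) :
    HasPartialExpectation ω
      (star (x • samField i + resField d φ) * (y • samField j + resField d ψ))
      ((conj x * y) • (star (samA i) * samA j) + ((σ : ℂ) * inner ℂ ψ φ) • 1) := by
  let a : Fin d → carAlgebra (Fin d) := fun k => algAnnihilation (site k)
  have h1 := (hasPartialExpectation_opTensor ω 1 (star (a i) * a j)).smul (conj x * y)
  have h2 := (hasPartialExpectation_opTensor ω (algAnnihilation ψ) (star (a i))).smul (conj x)
  have h3 := (hasPartialExpectation_opTensor ω (star (algAnnihilation φ)) (a j)).smul y
  have h4 := hasPartialExpectation_opTensor (κ := Fin d) ω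
    (star (algAnnihilation φ) * algAnnihilation ψ) 1
  rw [hω.map_one, one_smul] at h1
  rw [hω.annihilation_eq_zero, zero_smul, smul_zero] at h2
  rw [hω.creation_eq_zero, zero_smul, smul_zero] at h3
  rw [hω.two_point] at h4
  convert ((h1.add h2).add h3).add h4 using 1
  · have e1 : star (x • samField i + resField d φ) = conj x • opTensor 1 (star (samA i)) +
        opTensor (star (annihilation φ)) 1 := by
      rw [star_add, star_smul, samField, resField, star_opTensor, star_opTensor, star_one,
        star_one]; rfl
    rw [e1, samField, resField]
    simp only [add_mul, mul_add, smul_mul_assoc, mul_smul_comm, opTensor_mul, one_mul, mul_one,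
      smul_smul, smul_add]
    rw [mul_comm y]
    change (conj x * y) • opTensor 1 (star (samA i) * samA j) +
      y • opTensor (star (annihilation φ)) (samA j) +
      (conj x • opTensor (annihilation ψ) (star (samA i)) +
        opTensor (star (annihilation φ) * annihilation ψ) 1) =
      (conj x * y) • opTensor 1 (star (samA i) * samA j) +
      conj x • opTensor (annihilation ψ) (star (samA i)) +
      y • opTensor (star (annihilation φ)) (samA j) +
      opTensor (star (annihilation φ) * annihilation ψ) 1
    abel
  · rw [add_zero, add_zero, smul_apply, inner_smul_right]; rfl

/-- Each turn multiplies the sample part by `cos α` and emits a component into a reservoir mode not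
reached before. The orthogonality clause expresses this novelty and is what makes the norms add up
in the induction. -/
theorem exists_halfStep_pow_samField (α : ℝ) (m u : ℕ) (hu : u < d) :
    ∃ φ : OneParticle ℤ,
      (halfStep d α ^ (m * d)) (samField (Fin.ofNat d u)) =
        (Complex.cos α ^ m) • samField (Fin.ofNat d u) + resField d φ ∧
      inner ℂ φ φ = 1 - Complex.cos α ^ (2 * m) ∧
      ∀ j : ℕ, m * d + u ≤ j → inner ℂ φ (site (j : ℤ)) = (0 : ℂ) := by
  induction m with
  | zero => exact ⟨0, by simp [resField_zero], by simp, by simp⟩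
  | succ m ih =>
    obtain ⟨φ, h1, h2, h3⟩ := ih
    have hc : conj (Complex.cos α) = Complex.cos α := by
      rw [← Complex.cos_conj, Complex.conj_ofReal]
    have hs : conj (Complex.sin α) = Complex.sin α := by
      rw [← Complex.sin_conj, Complex.conj_ofReal]
    -- The emitted `b_u` has moved to `b_{md+u}` during the remaining `md` steps. Its coefficient
    -- `-i sin α` appears conjugated, as `c(φ)` is antilinear in `φ`.
    refine ⟨Complex.cos α • φ + (Complex.I * Complex.sin α) • site ((m * d + u : ℕ) : ℤ),
      ?_, ?_, fun j hj => ?_⟩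
    · rw [Nat.succ_mul, pow_add, Module.End.mul_apply, halfStep_pow_card_samField α hu, map_add,
        map_smul, map_smul, h1, halfStep_pow_resField, resField_add, resField_smul, resField_smul,
        map_mul, hc, hs, Complex.conj_I, smul_add, smul_smul, ← pow_succ', add_assoc, neg_mul]
    · have h4 := h3 (m * d + u) le_rfl
      have h5 : inner ℂ (site ((m * d + u : ℕ) : ℤ)) φ = (0 : ℂ) := by
        rw [← inner_conj_symm, h4, map_zero]
      rw [inner_add_left, inner_add_right, inner_add_right]
      simp only [inner_smul_left, inner_smul_right, h2, h4, h5,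
        orthonormal_iff_ite.1 orthonormal_site, if_true, map_mul, hc, hs, Complex.conj_I]
      have h6 := Complex.sin_sq_add_cos_sq α
      linear_combination (-Complex.sin α ^ 2) * Complex.I_sq + h6
    · have h4 : m * d + u < j := by
        have := NeZero.pos d
        rw [Nat.succ_mul] at hj
        omega
      rw [inner_add_left, inner_smul_left, inner_smul_left, h3 j h4.le,
        orthonormal_iff_ite.1 orthonormal_site, if_neg (by omega)]
      simp

theorem exists_halfStep_pow_samField_zero (α : ℝ) (t : ℕ) :
    ∃ φ : OneParticle ℤ,
      (halfStep d α ^ t) (samField 0) =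
        (Complex.cos α ^ (t / d)) • samField (Fin.ofNat d t) + resField d φ ∧
      inner ℂ φ φ = 1 - Complex.cos α ^ (2 * (t / d)) ∧
      inner ℂ φ (site (t : ℤ)) = (0 : ℂ) := by
  have hu := Nat.mod_lt t (NeZero.pos d)
  obtain ⟨φ, h1, h2, h3⟩ := exists_halfStep_pow_samField (d := d) α (t / d) (t % d) hu
  have ht : t / d * d + t % d = t := Nat.div_add_mod' t d
  refine ⟨φ, ?_, h2, h3 t ht.le⟩
  have h0 := halfStep_pow_samField (d := d) α (u := 0) (k := t % d) (by omega)
  have hm : Fin.ofNat d (t % d) = Fin.ofNat d t := by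
    apply Fin.ext; simp [Fin.ofNat]
  rw [zero_add] at h0
  rw [hm] at h0 h1
  rw [← h1, ← h0, ← Module.End.mul_apply, ← pow_add, ht]
  rfl

theorem card_mul_add_div (m : ℕ) (u : Fin d) : (m * d + (u : ℕ)) / d = m := by
  rw [mul_comm, Nat.mul_add_div (NeZero.pos d), Nat.div_eq_of_lt u.isLt, add_zero]

theorem ofNat_card_mul_add (m : ℕ) (u : Fin d) : Fin.ofNat d (m * d + (u : ℕ)) = u := by
  apply Fin.ext; simp [Fin.ofNat, Nat.mod_eq_of_lt u.isLt]

theorem evolve_add (α : ℝ) (t : ℕ) (X Y : Op (Total d)) :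
    evolve α t (X + Y) = evolve α t X + evolve α t Y := by
  simp [evolve, mul_add, add_mul]

theorem evolve_sub (α : ℝ) (t : ℕ) (X Y : Op (Total d)) :
    evolve α t (X - Y) = evolve α t X - evolve α t Y := by
  simp [evolve, mul_sub, sub_mul]

theorem evolve_smul (α : ℝ) (t : ℕ) (c : ℂ) (X : Op (Total d)) :
    evolve α t (c • X) = c • evolve α t X := by
  simp [evolve]

theorem evolve_sum {β : Type*} (s : Finset β) (α : ℝ) (t : ℕ) (X : β → Op (Total d)) :
    evolve α t (∑ i ∈ s, X i) = ∑ i ∈ s, evolve α t (X i) := by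
  simp [evolve, Finset.mul_sum, Finset.sum_mul]

theorem flux_eq (ε α : ℝ) : flux d ε α =
    ((Real.sin α ^ 2 : ℝ) : ℂ) • (star (samField 0) * samField 0 -
        star (resField d (site 0)) * resField d (site 0)) +
      (Complex.I * ((ε * Real.sin α * Real.cos α : ℝ) : ℂ)) •
        (star (resField d (site 0)) * samField 0 -
          star (samField 0) * resField d (site 0)) := by
  have h : resField d (site 0) = opTensor (resA 0) 1 := rfl
  rw [h, samField, star_opTensor, star_opTensor]
  simp only [opTensor_mul, star_one, one_mul, mul_one]
  rfl

theorem hasPartialExpectation_flux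
    (hω : IsQuasiFreeState ((σ : ℂ) • (1 : Op (OneParticle ℤ))) ω) (ε α : ℝ) (t : ℕ) :
    HasPartialExpectation ω (evolve α t (flux d ε α))
      (((Real.sin α ^ 2 * Real.cos α ^ (2 * (t / d)) : ℝ) : ℂ) •
        (samN (Fin.ofNat d t) - (σ : ℂ) • 1)) := by
  obtain ⟨φ, h1, h2, h3⟩ := exists_halfStep_pow_samField_zero (d := d) α t
  have h3' : inner ℂ (site (t : ℤ)) φ = (0 : ℂ) := by rw [← inner_conj_symm, h3, map_zero]
  -- The zero sample coefficient puts `b_t` in the form required by the bilinear formula.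
  have hb : (halfStep d α ^ t) (resField d (site 0)) =
      (0 : ℂ) • samField (Fin.ofNat d t) + resField d (site (t : ℤ)) := by
    rw [zero_smul, zero_add]; exact halfStep_pow_resField α t 0
  have hc : conj (Complex.cos α) = Complex.cos α := by
    rw [← Complex.cos_conj, Complex.conj_ofReal]
  rw [flux_eq, evolve_add, evolve_smul, evolve_smul, evolve_sub, evolve_sub, evolve_star_mul,
    evolve_star_mul, evolve_star_mul, evolve_star_mul, h1, hb]
  convert (((hasPartialExpectation_bilinear hω _ _ _ _ _ _).sub
    (hasPartialExpectation_bilinear hω _ _ _ _ _ _)).smul _).add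
    (((hasPartialExpectation_bilinear hω _ _ _ _ _ _).sub
    (hasPartialExpectation_bilinear hω _ _ _ _ _ _)).smul _) using 1
  -- `h3` and `h3'` remove the reservoir part of the exchange terms, and the zero coefficient
  -- removes their sample part; nothing depending on `ε` survives.
  rw [h2, h3, h3', orthonormal_iff_ite.1 orthonormal_site, if_pos rfl, map_pow, hc, map_zero,
    samN]
  push_cast
  module

/-- Being an observable is needed at every time, but the value only after complete turns, when each
site is back at its place and all sites carry the same power of `cos α`. -/
theorem hasPartialExpectation_samTotalN
    (hω : IsQuasiFreeState ((σ : ℂ) • (1 : Op (OneParticle ℤ))) ω) (α : ℝ) (t : ℕ) :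
    ∃ A, HasPartialExpectation ω (evolve α t (opTensor 1 (samTotalN d))) A ∧
      ∀ m, t = m * d → A = ((Real.cos α ^ (2 * m) : ℝ) : ℂ) • samTotalN d +
        (((1 - Real.cos α ^ (2 * m)) * (σ * d) : ℝ) : ℂ) • 1 := by
  have key : ∀ j : Fin d, HasPartialExpectation ω (evolve α t (star (samField j) * samField j))
      ((Complex.cos α ^ (2 * ((t + j) / d))) • samN (Fin.ofNat d (t + j)) +
        ((σ : ℂ) * (1 - Complex.cos α ^ (2 * ((t + j) / d)))) • 1) := by
    intro j
    obtain ⟨φ, h1, h2, -⟩ := exists_halfStep_pow_samField_zero (d := d) α (t + j)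
    have h0 := halfStep_pow_samField (d := d) α (u := 0) (k := j) (by omega)
    have hj : Fin.ofNat d j = j := by
      apply Fin.ext; simp [Fin.ofNat, Nat.mod_eq_of_lt j.isLt]
    have hc : conj (Complex.cos α) = Complex.cos α := by
      rw [← Complex.cos_conj, Complex.conj_ofReal]
    rw [zero_add, hj] at h0
    -- `a_j` is `a_0` evolved by `j` steps, so a single orbit serves all sites.
    have h4 : (halfStep d α ^ t) (samField j) = (halfStep d α ^ (t + (j : ℕ))) (samField 0) := by
      rw [← h0, ← Module.End.mul_apply, ← pow_add]; rfl
    rw [evolve_star_mul, h4, h1]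
    convert hasPartialExpectation_bilinear hω _ _ _ _ _ _ using 1
    rw [h2, map_pow, hc, ← pow_add, two_mul]; rfl
  have hN : opTensor 1 (samTotalN d) =
      ∑ j : Fin d, star (samField j) * samField j := by
    rw [samTotalN, opTensor_sum_right]
    refine Finset.sum_congr rfl fun j _ => ?_
    rw [samField, star_opTensor, opTensor_mul, star_one, one_mul]; rfl
  rw [hN, evolve_sum]
  refine ⟨_, HasPartialExpectation.sum _ fun j _ => key j, ?_⟩
  rintro m rfl
  simp only [card_mul_add_div, ofNat_card_mul_add, Finset.sum_add_distrib, ← Finset.smul_sum, Finset.sum_const,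
    Finset.card_univ, Fintype.card_fin]
  rw [samTotalN, ← Nat.cast_smul_eq_nsmul ℂ, smul_smul]
  push_cast
  congr 2
  ring

theorem sum_partialExpectation_flux
    (hω : IsQuasiFreeState ((σ : ℂ) • (1 : Op (OneParticle ℤ))) ω) (ε α : ℝ) (m : ℕ) :
    ∑ j ∈ Finset.range (m * d), partialExpectation ω (evolve α j (flux d ε α)) =
      ((1 - Real.cos α ^ (2 * m) : ℝ) : ℂ) • (samTotalN d - ((σ * d : ℝ) : ℂ) • 1) := by
  induction m with
  | zero => simp
  | succ m ih =>
    -- The last turn is split off: over its `d` steps the power of `cos α` is constant and every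
    -- site occurs once, producing `N_s - σd`.
    rw [Nat.succ_mul, Finset.sum_range_add, ih, Finset.sum_range]
    simp only [(hasPartialExpectation_flux hω ε α _).eq, card_mul_add_div, ofNat_card_mul_add]
    rw [← Finset.smul_sum, Finset.sum_sub_distrib, Finset.sum_const, Finset.card_univ,
      Fintype.card_fin, ← Nat.cast_smul_eq_nsmul ℂ, smul_smul, ← samTotalN, Real.sin_sq,
      mul_comm (d : ℂ)]
    push_cast
    module

end Model
end FermiWalk

theorem mainTheorem12 (d : ℕ) [NeZero d] (α σ : ℝ) (hσ0 : 0 ≤ σ) (hσ1 : σ ≤ 1)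
    (ω : carAlgebra ℤ →ₗ[ℂ] ℂ)
    (hω : IsQuasiFreeState ((σ : ℂ) • (1 : Op (OneParticle ℤ))) ω)
    (ε : ℝ) (hε : ε = 1 ∨ ε = -1) :
    (∀ t : ℕ, evolve α t (flux d ε α) ∈ observables ℤ (Fin d)) ∧
    (∀ t : ℕ, evolve α t (opTensor 1 (samTotalN d)) ∈ observables ℤ (Fin d)) ∧
    (∀ (m : ℕ) (u : Fin d),
      partialExpectation ω (evolve α (m * d + u) (flux d ε α)) =
        ((Real.sin α ^ 2 * Real.cos α ^ (2 * m) : ℝ) : ℂ) • (samN u - (σ : ℂ) • 1)) ∧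
    (∀ m : ℕ,
      ∑ j ∈ Finset.range (m * d), partialExpectation ω (evolve α j (flux d ε α)) =
        ((1 - Real.cos α ^ (2 * m) : ℝ) : ℂ) • (samTotalN d - ((σ * d : ℝ) : ℂ) • 1)) ∧
    (∀ m : ℕ,
      ∑ j ∈ Finset.range (m * d), partialExpectation ω (evolve α j (flux d ε α)) =
        samTotalN d - partialExpectation ω (evolve α (m * d) (opTensor 1 (samTotalN d)))) := by
  refine ⟨fun t => (hasPartialExpectation_flux hω ε α t).mem, fun t => ?_, fun m u => ?_,
    sum_partialExpectation_flux hω ε α, fun m => ?_⟩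
  · obtain ⟨A, hA, -⟩ := hasPartialExpectation_samTotalN (d := d) hω α t
    exact hA.mem
  · rw [(hasPartialExpectation_flux hω ε α _).eq, card_mul_add_div, ofNat_card_mul_add]
  · obtain ⟨A, hA, hA'⟩ := hasPartialExpectation_samTotalN (d := d) hω α (m * d)
    rw [sum_partialExpectation_flux hω, hA.eq, hA' m rfl]
    push_cast
    module
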